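/- **Lemma 4.1.** Let $M$ and $N$ be type II$_1$ von Neumann algebras (that is, finite and without nonzero abelian projections) acting on Hilbert spaces $H$ and $K$, with faithful normal unital traces $\tau_M$ and $\tau_N$ respectively. Let $M\overline\otimes N$ be their von Neumann algebra tensor product, the von Neumann algebra generated by the operators $a\otimes b$ $(a\in M,\ b\in N)$ on the Hilbert space tensor product of $H$ and $K$. Call a von Neumann algebra separable if it has a countable ultraweakly dense subset, and let von Neumann subalgebras contain the unit of the ambient algebra. If $Q\subseteq M\overline\otimes N$ is a separable von Neumann subalgebra, then there exist separable type II$_1$ von Neumann subalgebras $M_0\subseteq M$ and $N_0\subseteq N$ such that $Q\subseteq M_0\overline\otimes N_0$. -/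

import Mathlib

open scoped TensorProduct ComplexOrder InnerProductSpace

noncomputable section

section Ultraweak

variable {H : Type*} [NormedAddCommGroup H] [InnerProductSpace ℂ H]

/-- The functional `x ↦ ∑ₙ ⟪ηₙ, x ξₙ⟫` on `B(H)` attached to two square-summable sequences
of vectors `ξ`, `η`. -/
def vectorSeqFunctional (ξ η : lp (fun _ : ℕ => H) 2) (x : H →L[ℂ] H) : ℂ :=
  ∑' n, ⟪η n, x (ξ n)⟫_ℂ

/-- The series defining `vectorSeqFunctional` always converges (absolutely). -/
theorem summable_vectorSeqFunctional (ξ η : lp (fun _ : ℕ => H) 2) (x : H →L[ℂ] H) :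
    Summable fun n => ⟪η n, x (ξ n)⟫_ℂ := by
  have h : Summable fun n => ‖η n‖ * ‖ξ n‖ :=
    lp.summable_mul (by rw [Real.holderConjugate_iff]; norm_num) η ξ
  refine .of_norm_bounded (h.mul_left ‖x‖) fun n => ?_
  calc ‖⟪η n, x (ξ n)⟫_ℂ‖ ≤ ‖η n‖ * ‖x (ξ n)‖ := norm_inner_le_norm _ _
    _ ≤ ‖η n‖ * (‖x‖ * ‖ξ n‖) := by gcongr; exact x.le_opNorm _
    _ = ‖x‖ * (‖η n‖ * ‖ξ n‖) := by ring

variable (H) in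
/-- The ultraweak (σ-weak) topology on `B(H)`: the coarsest topology making all the functionals
`x ↦ ∑ₙ ⟪ηₙ, x ξₙ⟫`, with `∑ ‖ξₙ‖² < ∞` and `∑ ‖ηₙ‖² < ∞`, continuous. -/
@[reducible] def ultraweakTopology : TopologicalSpace (H →L[ℂ] H) :=
  TopologicalSpace.induced
    (fun (x : H →L[ℂ] H) (p : lp (fun _ : ℕ => H) 2 × lp (fun _ : ℕ => H) 2) =>
      vectorSeqFunctional p.1 p.2 x)
    Pi.topologicalSpace

end Ultraweak

namespace VonNeumannAlgebra

variable {H : Type*} [NormedAddCommGroup H] [InnerProductSpace ℂ H] [CompleteSpace H]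

/-- A von Neumann algebra is separable if it has a countable ultraweakly dense subset. -/
def IsSeparable (M : VonNeumannAlgebra H) : Prop :=
  ∃ S : Set (H →L[ℂ] H), S.Countable ∧ S ⊆ (M : Set (H →L[ℂ] H)) ∧
    (M : Set (H →L[ℂ] H)) ⊆ @closure _ (ultraweakTopology H) S

/-- A von Neumann algebra is finite if each of its isometries is unitary. -/
def IsFinite (M : VonNeumannAlgebra H) : Prop :=
  ∀ v ∈ M, star v * v = 1 → v * star v = 1

/-- `e` is an abelian projection of `M`: a projection in `M` such that `e M e` is commutative. -/
def IsAbelianProjection (M : VonNeumannAlgebra H) (e : H →L[ℂ] H) : Prop :=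
  e ∈ M ∧ IsStarProjection e ∧
    ∀ x ∈ M, ∀ y ∈ M, (e * x * e) * (e * y * e) = (e * y * e) * (e * x * e)

/-- A von Neumann algebra is of type II₁ if it is finite and has no nonzero abelian projection. -/
def IsTypeII1 (M : VonNeumannAlgebra H) : Prop :=
  M.IsFinite ∧ ∀ e, M.IsAbelianProjection e → e = 0

/-- `τ` is a faithful normal unital trace on `M` (a faithful normal tracial state).
Normality is ultraweak continuity. -/
structure IsFaithfulNormalTrace (M : VonNeumannAlgebra H)
    (τ : M.toStarSubalgebra →ₗ[ℂ] ℂ) : Prop where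
  map_one : τ 1 = 1
  map_mul_comm : ∀ x y, τ (x * y) = τ (y * x)
  nonneg : ∀ x, 0 ≤ τ (star x * x)
  faithful : ∀ x, τ (star x * x) = 0 → x = 0
  normal : @Continuous _ _ ((ultraweakTopology H).induced Subtype.val) inferInstance τ

/-- The von Neumann algebra generated by a set of operators: the double commutant of the
set and its adjoints. -/
def generatedBy (S : Set (H →L[ℂ] H)) : VonNeumannAlgebra H where
  toStarSubalgebra :=
    StarSubalgebra.centralizer ℂ (StarSubalgebra.centralizer ℂ S : Set (H →L[ℂ] H))
  centralizer_centralizer' := by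
    change Set.centralizer (Set.centralizer
      (StarSubalgebra.centralizer ℂ (StarSubalgebra.centralizer ℂ S : Set (H →L[ℂ] H)) :
        Set (H →L[ℂ] H))) =
      (StarSubalgebra.centralizer ℂ (StarSubalgebra.centralizer ℂ S : Set (H →L[ℂ] H)) :
        Set (H →L[ℂ] H))
    rw [StarSubalgebra.coe_centralizer_centralizer, Set.centralizer_centralizer_centralizer]

end VonNeumannAlgebra

section Tensor

/-- The Hilbert space tensor product of `H` and `K`: the completion of the algebraic tensor
product for the inner product `⟪ξ ⊗ η, ξ' ⊗ η'⟫ = ⟪ξ, ξ'⟫ ⟪η, η'⟫`. -/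
abbrev HilbertTensor (H K : Type*) [NormedAddCommGroup H] [InnerProductSpace ℂ H]
    [NormedAddCommGroup K] [InnerProductSpace ℂ K] : Type _ :=
  UniformSpace.Completion (H ⊗[ℂ] K)

variable {H : Type*} [NormedAddCommGroup H] [InnerProductSpace ℂ H]
  {K : Type*} [NormedAddCommGroup K] [InnerProductSpace ℂ K]

/-- The operator `a ⊗ b` on the Hilbert space tensor product. -/
def tensorOperator (a : H →L[ℂ] H) (b : K →L[ℂ] K) :
    HilbertTensor H K →L[ℂ] HilbertTensor H K :=
  (TensorProduct.mapL a b).completion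

/-- `a ⊗ b` acts on elementary tensors by `(a ⊗ b)(ξ ⊗ η) = a ξ ⊗ b η`. -/
theorem tensorOperator_tmul (a : H →L[ℂ] H) (b : K →L[ℂ] K) (ξ : H) (η : K) :
    tensorOperator a b ((ξ ⊗ₜ[ℂ] η : H ⊗[ℂ] K) : HilbertTensor H K) =
      ((a ξ ⊗ₜ[ℂ] b η : H ⊗[ℂ] K) : HilbertTensor H K) := by
  simp [tensorOperator]

/-- The von Neumann algebra tensor product of `M ⊆ B(H)` and `N ⊆ B(K)`: the von Neumann algebra
on the Hilbert space tensor product generated by all `a ⊗ b` with `a ∈ M` and `b ∈ N`. -/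
def VonNeumannAlgebra.tensor [CompleteSpace H] [CompleteSpace K]
    (M : VonNeumannAlgebra H) (N : VonNeumannAlgebra K) :
    VonNeumannAlgebra (HilbertTensor H K) :=
  VonNeumannAlgebra.generatedBy {T | ∃ a ∈ M, ∃ b ∈ N, T = tensorOperator a b}

end Tensor

end

/-!
The two halves of the statement, that `Q` only involves countably many elements of `M` and `N`, and
that countably many elements of a type II₁ algebra lie in a separable type II₁ subalgebra, are
independent of each other. The Hilbert spaces need not be separable, so density statements give nets
rather than sequences; in both halves the traces are what makes countably many operators suffice.

**Countably many elementary tensors.** A faithful normal trace is ultraweakly continuous, so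
countably many vectors `Ω` of `H` separate `M`
(`VonNeumannAlgebra.IsFaithfulNormalTrace.exists_countable_separating`); they are then cyclic for
the commutant of `M`, and the elementary tensors of two such families are cyclic for the commutant
of `M ⊗ N`. Let `q ∈ M ⊗ N` and let `R` be a von Neumann subalgebra of `M ⊗ N`. If for any two of
these vectors `ω`, `ω'` the pair `(q ω, q* ω')` is a limit of pairs `(t ω, t* ω')` with `t ∈ R`,
then `q` commutes with the commutant of `R`, and thus `q ∈ R`: for `y` in this commutant and `a`,
`b` in the commutant of `M ⊗ N` the operators `t` and `y` commute in `⟪a ω', y t b ω⟫`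
(`VonNeumannAlgebra.mem_of_mem_closure_image_star`). No boundedness of the approximants is needed,
which avoids Kaplansky's density theorem. By the double commutant theorem and convexity such limits
exist within the span of the elementary tensors (`mem_closure_image_star`), and being limits in a
metric space they use only a sequence of these, for each of countably many pairs `ω`, `ω'`.

**Separable subalgebras of type II₁.** Finiteness passes to subalgebras, but a subalgebra may have
abelian projections that are not abelian in `M`. This is excluded by a downward
Löwenheim–Skolem argument in the trace seminorm `‖x‖₂² = τ(x* x)`
(`VonNeumannAlgebra.exists_separable_isTypeII1`). For bounded `a`, the supremum over contractions
`x`, `y` of `M` of `‖a x a y a - a y a x a‖₂` measures how far `a` is from being abelian, and it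
depends continuously on `a`. The countable generating set is closed under adding a pair `x`, `y`
that attains at least half of the squared supremum, for suitable `a` approximating all the
projections of the generated algebra. So a projection that is abelian in the subalgebra is abelian
in `M`, hence zero. The bounded approximants are obtained from arbitrary self-adjoint ones `t` as
`(1 - i) (1 - (1 + i t)⁻¹)`, a bounded function with value `0` at `0` and `1` at `1`.
-/

noncomputable section

/-! ### The double commutant theorem, with scalars from a dense set -/

section Amplification

variable {H : Type*} [NormedAddCommGroup H] [InnerProductSpace ℂ H] {ι : Type*}

/-- The diagonal operator `(ξᵢ)ᵢ ↦ (x ξᵢ)ᵢ` on `ℓ²(ι, H)`. -/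
def amplify (x : H →L[ℂ] H) :
    lp (fun _ : ι => H) 2 →L[ℂ] lp (fun _ : ι => H) 2 :=
  have hmem (ξ : lp (fun _ : ι => H) 2) : Memℓp (fun i => x (ξ i)) 2 := by
    have h := ((memℓp_gen_iff (by norm_num)).1 (lp.memℓp ξ)).mul_left (‖x‖ ^ (2 : ℝ))
    refine memℓp_gen (.of_nonneg_of_le (fun i => by positivity) (fun i => ?_) h)
    simp only [ENNReal.toReal_ofNat]
    rw [← Real.mul_rpow (norm_nonneg _) (norm_nonneg _)]
    exact Real.rpow_le_rpow (norm_nonneg _) (x.le_opNorm _) (by norm_num)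
  LinearMap.mkContinuous
    { toFun := fun ξ => ⟨fun i => x (ξ i), hmem ξ⟩
      map_add' := fun ξ ζ => lp.ext (funext fun i => map_add x (ξ i) (ζ i))
      map_smul' := fun c ξ => lp.ext (funext fun i => map_smul x c (ξ i)) } ‖x‖ fun ξ => by
    refine lp.norm_le_of_forall_sum_le (by norm_num) (by positivity) fun s => ?_
    rw [Real.mul_rpow (norm_nonneg _) (norm_nonneg _)]
    refine le_trans ?_ (mul_le_mul_of_nonneg_left
      (lp.sum_rpow_le_norm_rpow (by norm_num) ξ s) (by positivity))
    rw [Finset.mul_sum]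
    refine Finset.sum_le_sum fun i _ => ?_
    rw [← Real.mul_rpow (norm_nonneg _) (norm_nonneg _)]
    exact Real.rpow_le_rpow (norm_nonneg _) (x.le_opNorm _) (by norm_num)

@[simp]
theorem amplify_apply (x : H →L[ℂ] H) (ξ : lp (fun _ : ι => H) 2) (i : ι) :
    amplify x ξ i = x (ξ i) := rfl

theorem amplify_add (x y : H →L[ℂ] H) (ξ : lp (fun _ : ι => H) 2) :
    amplify (x + y) ξ = amplify x ξ + amplify y ξ := lp.ext rfl

theorem amplify_sub (x y : H →L[ℂ] H) (ξ : lp (fun _ : ι => H) 2) :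
    amplify (x - y) ξ = amplify x ξ - amplify y ξ := lp.ext rfl

theorem amplify_smul (c : ℂ) (x : H →L[ℂ] H) (ξ : lp (fun _ : ι => H) 2) :
    amplify (c • x) ξ = c • amplify x ξ := lp.ext rfl

theorem amplify_mul (x y : H →L[ℂ] H) (ξ : lp (fun _ : ι => H) 2) :
    amplify (x * y) ξ = amplify x (amplify y ξ) := lp.ext rfl

theorem amplify_one (ξ : lp (fun _ : ι => H) 2) : amplify 1 ξ = ξ := lp.ext rfl

theorem inner_amplify_left [CompleteSpace H] (x : H →L[ℂ] H) (ξ ζ : lp (fun _ : ι => H) 2) :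
    ⟪amplify x ξ, ζ⟫_ℂ = ⟪ξ, amplify (star x) ζ⟫_ℂ := by
  simp only [lp.inner_eq_tsum, amplify_apply, ContinuousLinearMap.star_eq_adjoint,
    ContinuousLinearMap.adjoint_inner_right]

theorem vectorSeqFunctional_eq_inner (ξ η : lp (fun _ : ℕ => H) 2) (x : H →L[ℂ] H) :
    vectorSeqFunctional ξ η x = ⟪η, amplify x ξ⟫_ℂ := by
  simp [vectorSeqFunctional, lp.inner_eq_tsum]

end Amplification

/-- A set of operators that is a `*`-algebra except that it need only be stable under
multiplication by a dense set of scalars; unlike a complex `*`-algebra it can be countable. -/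
structure IsDenseScalarStarAlgebra {A : Type*} [Ring A] [StarRing A] [Algebra ℂ A] (T : Set A) :
    Prop where
  one_mem : 1 ∈ T
  add_mem : ∀ x ∈ T, ∀ y ∈ T, x + y ∈ T
  mul_mem : ∀ x ∈ T, ∀ y ∈ T, x * y ∈ T
  star_mem : ∀ x ∈ T, star x ∈ T
  dense_smul : Dense {c : ℂ | ∀ x ∈ T, c • x ∈ T}

/-- The orthogonal projection onto a subspace invariant under an operator `a` and its adjoint `b`
commutes with `a`. -/
theorem starProjection_comm_of_invariant {E : Type*} [NormedAddCommGroup E]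
    [InnerProductSpace ℂ E] {V : Submodule ℂ E} [V.HasOrthogonalProjection]
    {a b : E →L[ℂ] E} (hab : ∀ v w, ⟪w, a v⟫_ℂ = ⟪b w, v⟫_ℂ)
    (ha : ∀ v ∈ V, a v ∈ V) (hb : ∀ v ∈ V, b v ∈ V) (v : E) :
    V.starProjection (a v) = a (V.starProjection v) := by
  refine (Submodule.eq_starProjection_of_mem_orthogonal
    (ha _ (Submodule.starProjection_apply_mem V v)) ?_)
  rw [← map_sub, Submodule.mem_orthogonal]
  intro w hw
  rw [hab]
  exact (Submodule.mem_orthogonal _ _).1 (Submodule.sub_starProjection_mem_orthogonal v) _ (hb w hw)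

section DoubleCommutant

variable {H : Type*} [NormedAddCommGroup H] [InnerProductSpace ℂ H] [CompleteSpace H]

variable {ι : Type*}

/-- The closure of the orbit of a vector of `ℓ²(ι, H)` under the amplification of `T`. -/
def amplifiedOrbit {T : Set (H →L[ℂ] H)} (hT : IsDenseScalarStarAlgebra T)
    (ξ : lp (fun _ : ι => H) 2) : Submodule ℂ (lp (fun _ : ι => H) 2) :=
  have hsmul (c : ℂ) {v : lp (fun _ : ι => H) 2} (hv : v ∈ closure ((amplify · ξ) '' T)) :
      c • v ∈ closure ((amplify · ξ) '' T) := by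
    refine map_mem_closure₂ (f := fun (c : ℂ) (v : lp (fun _ : ι => H) 2) => c • v)
      continuous_smul (hT.dense_smul c) hv ?_
    rintro c hc - ⟨t, ht, rfl⟩
    exact ⟨c • t, hc t ht, amplify_smul c t ξ⟩
  { carrier := closure ((amplify · ξ) '' T)
    add_mem' := fun hv hw => by
      refine map_mem_closure₂ continuous_add hv hw ?_
      rintro - ⟨t, ht, rfl⟩ - ⟨s, hs, rfl⟩
      exact ⟨t + s, hT.add_mem t ht s hs, amplify_add t s ξ⟩
    zero_mem' := by
      simpa using hsmul 0 (subset_closure (Set.mem_image_of_mem _ hT.one_mem))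
    smul_mem' := fun c _ hv => hsmul c hv }

theorem amplify_mem_amplifiedOrbit {T : Set (H →L[ℂ] H)} (hT : IsDenseScalarStarAlgebra T)
    (ξ : lp (fun _ : ι => H) 2) {t : H →L[ℂ] H} (ht : t ∈ T) {v : lp (fun _ : ι => H) 2}
    (hv : v ∈ amplifiedOrbit hT ξ) : amplify t v ∈ amplifiedOrbit hT ξ := by
  refine map_mem_closure (amplify t).continuous hv ?_
  rintro - ⟨s, hs, rfl⟩
  exact ⟨t * s, hT.mul_mem t ht s hs, amplify_mul t s ξ⟩

/-- The matrix coefficients of the projection onto `amplifiedOrbit hT ξ` lie in the commutant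
of `T`, so this projection commutes with the amplification of the double commutant. -/
theorem amplify_mem_closure_of_mem_doubleCommutant {T : Set (H →L[ℂ] H)}
    (hT : IsDenseScalarStarAlgebra T) {x : H →L[ℂ] H}
    (hx : x ∈ Set.centralizer (Set.centralizer T)) (ξ : lp (fun _ : ι => H) 2) :
    amplify x ξ ∈ closure ((amplify · ξ) '' T) := by
  classical
  set V := amplifiedOrbit hT ξ
  have hVc : IsClosed (V : Set (lp (fun _ : ι => H) 2)) := isClosed_closure
  have : CompleteSpace V := hVc.completeSpace_coe
  set P := V.starProjection
  have hPT (t : H →L[ℂ] H) (ht : t ∈ T) (v : lp (fun _ : ι => H) 2) :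
      P (amplify t v) = amplify t (P v) :=
    starProjection_comm_of_invariant (b := amplify (star t))
      (fun v w => by rw [inner_amplify_left, star_star])
      (fun v => amplify_mem_amplifiedOrbit hT ξ ht)
      (fun v => amplify_mem_amplifiedOrbit hT ξ (hT.star_mem t ht)) v
  let single (j : ι) : H →L[ℂ] lp (fun _ : ι => H) 2 :=
    lp.singleContinuousLinearMap ℂ (fun _ : ι => H) 2 j
  have hsingle (y : H →L[ℂ] H) (j : ι) (h : H) : amplify y (single j h) = single j (y h) := by
    refine lp.ext (funext fun i => ?_)
    rw [amplify_apply]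
    change y (Pi.single (M := fun _ : ι => H) j h i) = Pi.single (M := fun _ : ι => H) j (y h) i
    by_cases hij : i = j
    · subst hij; simp
    · simp [hij]
  let ev (i : ι) : lp (fun _ : ι => H) 2 →L[ℂ] H :=
    LinearMap.mkContinuous
      { toFun := fun v => v i, map_add' := fun _ _ => rfl, map_smul' := fun _ _ => rfl } 1
      fun v => by
        rw [one_mul]
        exact lp.norm_apply_le_norm (by norm_num) v i
  have hcoeff (i j : ι) : (ev i ∘L P ∘L single j) ∈ Set.centralizer T := by
    rw [Set.mem_centralizer_iff]
    intro t ht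
    ext h
    change t (ev i (P (single j h))) = ev i (P (single j (t h)))
    rw [← hsingle, hPT t ht]
    rfl
  have hPx (v : lp (fun _ : ι => H) 2) : P (amplify x v) = amplify x (P v) := by
    have hs : HasSum (fun j => single j (v j)) v :=
      lp.hasSum_single (by norm_num) v
    have h₁ := (hs.mapL (amplify x)).mapL P
    have h₂ := (hs.mapL P).mapL (amplify x)
    refine h₁.unique ?_
    convert h₂ using 2 with j
    refine lp.ext (funext fun i => ?_)
    have := congrArg (fun f : H →L[ℂ] H => f (v j))
      (Set.mem_centralizer_iff.1 hx _ (hcoeff i j))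
    rw [hsingle]
    exact this
  have hξ : ξ ∈ V := subset_closure ⟨1, hT.one_mem, amplify_one ξ⟩
  have : amplify x ξ ∈ V := by
    have h := hPx ξ
    rw [Submodule.starProjection_eq_self_iff.2 hξ] at h
    exact Submodule.starProjection_eq_self_iff.1 h
  exact this

/-- The vectors `ξ p` are joined into one vector indexed by `ι × ℕ`. -/
theorem exists_amplify_sub_lt {T : Set (H →L[ℂ] H)} (hT : IsDenseScalarStarAlgebra T)
    {x : H →L[ℂ] H} (hx : x ∈ Set.centralizer (Set.centralizer T)) [Finite ι]
    (ξ : ι → lp (fun _ : ℕ => H) 2) {ε : ℝ} (hε : 0 < ε) :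
    ∃ t ∈ T, ∀ p, ‖amplify (t - x) (ξ p)‖ < ε := by
  have hmem : Memℓp (fun q : ι × ℕ => ξ q.1 q.2) 2 := by
    refine memℓp_gen ?_
    rw [summable_prod_of_nonneg (fun q => by positivity)]
    exact ⟨fun p => (memℓp_gen_iff (by norm_num)).1 (lp.memℓp (ξ p)), Summable.of_finite⟩
  let Ξ : lp (fun _ : ι × ℕ => H) 2 := ⟨_, hmem⟩
  obtain ⟨-, ⟨t, ht, rfl⟩, hlt⟩ := Metric.mem_closure_iff.1
    (amplify_mem_closure_of_mem_doubleCommutant hT hx Ξ) ε hε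
  rw [dist_comm, dist_eq_norm, ← amplify_sub] at hlt
  refine ⟨t, ht, fun p => lt_of_le_of_lt ?_ hlt⟩
  refine lp.norm_le_of_forall_sum_le (by norm_num) (norm_nonneg _) fun s => ?_
  refine le_trans (le_of_eq ?_) (lp.sum_rpow_le_norm_rpow (by norm_num) (amplify (t - x) Ξ)
    (s.map ⟨fun n => (p, n), fun a b h => by simpa using h⟩))
  rw [Finset.sum_map]
  rfl

end DoubleCommutant

/-! ### The ultraweak topology and generated von Neumann algebras -/

section Ultraweak

variable {H : Type*} [NormedAddCommGroup H] [InnerProductSpace ℂ H]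

theorem exists_finset_of_mem_nhds_ultraweak {x : H →L[ℂ] H} {U : Set (H →L[ℂ] H)}
    (hU : U ∈ @nhds _ (ultraweakTopology H) x) :
    ∃ F : Finset (lp (fun _ : ℕ => H) 2 × lp (fun _ : ℕ => H) 2), ∃ δ > 0,
      ∀ y, (∀ p ∈ F, ‖⟪p.2, amplify (y - x) p.1⟫_ℂ‖ < δ) → y ∈ U := by
  rw [nhds_induced, Filter.mem_comap] at hU
  obtain ⟨V, hV, hVU⟩ := hU
  rw [nhds_pi, Filter.mem_pi] at hV
  obtain ⟨I, hI, t, ht, htV⟩ := hV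
  have h : ∀ᶠ δ : ℝ in nhdsWithin 0 (Set.Ioi 0),
      ∀ p ∈ I, Metric.ball (vectorSeqFunctional p.1 p.2 x) δ ⊆ t p := by
    rw [Filter.eventually_all_finite hI]
    intro p _
    obtain ⟨δ, hδ, hball⟩ := Metric.mem_nhds_iff.1 (ht p)
    filter_upwards [Ioo_mem_nhdsGT hδ] with r hr
    exact (Metric.ball_subset_ball hr.2.le).trans hball
  obtain ⟨δ, hδI, hδ⟩ := (h.and self_mem_nhdsWithin).exists
  refine ⟨hI.toFinset, δ, hδ, fun y hy => hVU (htV fun p hp => hδI p hp ?_)⟩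
  have := hy p (hI.mem_toFinset.2 hp)
  rw [amplify_sub, inner_sub_right] at this
  simpa [dist_eq_norm, vectorSeqFunctional_eq_inner] using this

theorem continuous_vectorSeqFunctional (ξ η : lp (fun _ : ℕ => H) 2) :
    @Continuous _ _ (ultraweakTopology H) inferInstance (vectorSeqFunctional ξ η) :=
  @Continuous.comp _ _ _ (ultraweakTopology H) _ _
    (fun x (p : lp (fun _ : ℕ => H) 2 × lp (fun _ : ℕ => H) 2) => vectorSeqFunctional p.1 p.2 x)
    (fun f => f (ξ, η)) (continuous_apply _) continuous_induced_dom

theorem continuous_inner_apply_ultraweak (u v : H) :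
    @Continuous _ _ (ultraweakTopology H) inferInstance fun x : H →L[ℂ] H => ⟪u, x v⟫_ℂ := by
  convert continuous_vectorSeqFunctional (lp.single 2 0 v) (lp.single 2 0 u) using 2 with x
  rw [vectorSeqFunctional_eq_inner, lp.inner_single_left]
  simp

variable [CompleteSpace H]

theorem closure_ultraweak_subset {M : VonNeumannAlgebra H} {S : Set (H →L[ℂ] H)}
    (hS : S ⊆ (M : Set (H →L[ℂ] H))) :
    @closure _ (ultraweakTopology H) S ⊆ (M : Set (H →L[ℂ] H)) := by
  intro x hx
  rw [← M.centralizer_centralizer, Set.mem_centralizer_iff]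
  intro y hy
  ext v
  refine ext_inner_left ℂ fun u => ?_
  have hcl : @IsClosed _ (ultraweakTopology H)
      {z : H →L[ℂ] H | ⟪star y u, z v⟫_ℂ = ⟪u, z (y v)⟫_ℂ} :=
    @isClosed_eq _ _ _ (ultraweakTopology H) _ _ _ (continuous_inner_apply_ultraweak _ _)
      (continuous_inner_apply_ultraweak _ _)
  have hmem := @closure_minimal _ (ultraweakTopology H) _ _ (fun z hz => ?_) hcl x hx
  · simpa [ContinuousLinearMap.star_eq_adjoint, ContinuousLinearMap.adjoint_inner_left] using hmem
  · have h := congrArg (fun f : H →L[ℂ] H => f v) (Set.mem_centralizer_iff.1 hy z (hS hz))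
    simp only [mul_apply_eq_comp] at h
    simp [ContinuousLinearMap.star_eq_adjoint, ContinuousLinearMap.adjoint_inner_left, h]

theorem mem_closure_ultraweak_of_mem_doubleCommutant {T : Set (H →L[ℂ] H)}
    (hT : IsDenseScalarStarAlgebra T) {x : H →L[ℂ] H}
    (hx : x ∈ Set.centralizer (Set.centralizer T)) :
    x ∈ @closure _ (ultraweakTopology H) T := by
  refine (@mem_closure_iff_nhds _ (ultraweakTopology H) _ _).2 fun U hU => ?_
  obtain ⟨F, δ, hδ, hF⟩ := exists_finset_of_mem_nhds_ultraweak hU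
  obtain ⟨C, hC⟩ : ∃ C : ℝ, ∀ p ∈ F, ‖p.2‖ ≤ C :=
    (F.image fun p => ‖p.2‖).exists_le.imp fun C h p hp => h _ (Finset.mem_image_of_mem _ hp)
  obtain ⟨t, ht, hlt⟩ := exists_amplify_sub_lt hT hx (fun p : F => p.1.1)
    (ε := δ / (|C| + 1)) (by positivity)
  refine ⟨t, hF t fun p hp => ?_, ht⟩
  have h₁ := hlt ⟨p, hp⟩
  rw [lt_div_iff₀ (by positivity)] at h₁
  have h₂ : ‖p.2‖ ≤ |C| + 1 := (hC p hp).trans ((le_abs_self C).trans (by linarith))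
  calc _ ≤ ‖p.2‖ * ‖amplify (t - x) p.1‖ := norm_inner_le_norm _ _
    _ ≤ (|C| + 1) * ‖amplify (t - x) p.1‖ := by gcongr
    _ < δ := by linarith

end Ultraweak

namespace VonNeumannAlgebra

variable {H : Type*} [NormedAddCommGroup H] [InnerProductSpace ℂ H] [CompleteSpace H]

theorem coe_generatedBy (S : Set (H →L[ℂ] H)) :
    (generatedBy S : Set (H →L[ℂ] H)) = Set.centralizer (Set.centralizer (S ∪ star S)) :=
  StarSubalgebra.coe_centralizer_centralizer ℂ S

theorem subset_generatedBy (S : Set (H →L[ℂ] H)) : S ⊆ (generatedBy S : Set (H →L[ℂ] H)) := by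
  rw [coe_generatedBy]
  exact Set.subset_union_left.trans Set.subset_centralizer_centralizer

theorem generatedBy_le {S : Set (H →L[ℂ] H)} {M : VonNeumannAlgebra H}
    (h : S ⊆ (M : Set (H →L[ℂ] H))) : generatedBy S ≤ M := by
  rw [← SetLike.coe_subset_coe, coe_generatedBy, ← M.centralizer_centralizer]
  refine Set.centralizer_subset (Set.centralizer_subset (Set.union_subset h fun x hx => ?_))
  rw [← star_star x]
  exact star_mem (h hx)

theorem coe_generatedBy_of_star_mem {T : Set (H →L[ℂ] H)} (hT : ∀ x ∈ T, star x ∈ T) :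
    (generatedBy T : Set (H →L[ℂ] H)) = Set.centralizer (Set.centralizer T) := by
  rw [coe_generatedBy, Set.union_eq_self_of_subset_right fun x hx => ?_]
  rw [← star_star x]
  exact hT _ hx

theorem isSeparable_generatedBy {T : Set (H →L[ℂ] H)} (hT : IsDenseScalarStarAlgebra T)
    (hc : T.Countable) : (generatedBy T).IsSeparable := by
  refine ⟨T, hc, subset_generatedBy T, fun x hx => ?_⟩
  rw [coe_generatedBy_of_star_mem hT.star_mem] at hx
  exact mem_closure_ultraweak_of_mem_doubleCommutant hT hx

end VonNeumannAlgebra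

/-! ### Countable sets closed under countably many operations -/

theorem Set.Countable.exists_countable_closed {α ι : Type*} [Countable ι] {S : Set α}
    (hS : S.Countable) (F : ι → α → α → α) :
    ∃ T : Set α, T.Countable ∧ S ⊆ T ∧ ∀ i, ∀ a ∈ T, ∀ b ∈ T, F i a b ∈ T := by
  let step (U : Set α) : Set α := U ∪ ⋃ i, Set.image2 (F i) U U
  let T (n : ℕ) : Set α := step^[n] S
  have hsucc (n : ℕ) : T (n + 1) = step (T n) := Function.iterate_succ_apply' step n S
  have hmono : Monotone T := monotone_nat_of_le_succ fun n => by
    rw [hsucc]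
    exact Set.subset_union_left
  refine ⟨⋃ n, T n, Set.countable_iUnion fun n => ?_, Set.subset_iUnion T 0, ?_⟩
  · induction n with
    | zero => exact hS
    | succ n ih =>
      rw [hsucc]
      exact ih.union (Set.countable_iUnion fun i => ih.image2 ih (F i))
  · intro i a ha b hb
    obtain ⟨m, ha⟩ := Set.mem_iUnion.1 ha
    obtain ⟨n, hb⟩ := Set.mem_iUnion.1 hb
    refine Set.mem_iUnion.2 ⟨max m n + 1, ?_⟩
    rw [hsucc]
    exact Or.inr (Set.mem_iUnion.2 ⟨i, a, hmono (le_max_left m n) ha, b,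
      hmono (le_max_right m n) hb, rfl⟩)

/-! ### The trace seminorm -/

/-- For a projection `a` this is the commutator of the compressions `a x a` and `a y a`. -/
def compressedCommutator {A : Type*} [Ring A] (a x y : A) : A :=
  a * x * a * y * a - a * y * a * x * a

theorem compressedCommutator_eq {A : Type*} [Ring A] {e : A} (he : IsIdempotentElem e) (x y : A) :
    compressedCommutator e x y =
      (e * x * e) * (e * y * e) - (e * y * e) * (e * x * e) := by
  have h (u v : A) : e * u * e * (e * v * e) = e * u * e * v * e := by
    simp only [← mul_assoc]
    rw [mul_assoc _ e e, he.eq]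
  rw [h, h, compressedCommutator]

section TraceSq

variable {A : Type*} [Ring A] [StarRing A] [Algebra ℂ A]

/-- The square `‖x‖₂² = τ(x* x)` of the seminorm attached to a positive functional `τ`. -/
def traceSq (τ : A →ₗ[ℂ] ℂ) (x : A) : ℝ := (τ (star x * x)).re

/-- A positive trace on a `*`-algebra. -/
structure IsPositiveTrace (τ : A →ₗ[ℂ] ℂ) : Prop where
  map_mul_comm : ∀ x y, τ (x * y) = τ (y * x)
  nonneg : ∀ x, 0 ≤ τ (star x * x)

/-- Left and right multiplication by `a` enlarge `traceSq` by a factor of at most `C`. -/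
structure IsTraceBounded (τ : A →ₗ[ℂ] ℂ) (C : ℝ) (a : A) : Prop where
  left : ∀ x, traceSq τ (a * x) ≤ C * traceSq τ x
  right : ∀ x, traceSq τ (x * a) ≤ C * traceSq τ x

namespace IsPositiveTrace

variable {τ : A →ₗ[ℂ] ℂ}

theorem traceSq_nonneg (hτ : IsPositiveTrace τ) (x : A) : 0 ≤ traceSq τ x :=
  (Complex.le_def.1 (hτ.nonneg x)).1

theorem map_star_mul_self (hτ : IsPositiveTrace τ) (x : A) : τ (star x * x) = traceSq τ x :=
  Complex.ext rfl (Complex.le_def.1 (hτ.nonneg x)).2.symm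

theorem traceSq_star (hτ : IsPositiveTrace τ) (x : A) : traceSq τ (star x) = traceSq τ x := by
  rw [traceSq, traceSq, star_star, hτ.map_mul_comm]

theorem traceSq_neg (x : A) : traceSq τ (-x) = traceSq τ x := by simp [traceSq]

/-- A weak triangle inequality, from the parallelogram law. -/
theorem traceSq_add_le (hτ : IsPositiveTrace τ) (x y : A) :
    traceSq τ (x + y) ≤ 2 * traceSq τ x + 2 * traceSq τ y := by
  have h : traceSq τ (x + y) + traceSq τ (x - y) = 2 * traceSq τ x + 2 * traceSq τ y := by
    simp only [traceSq, star_add, star_sub, mul_add, add_mul, mul_sub, sub_mul, map_add, map_sub,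
      Complex.add_re, Complex.sub_re]
    ring
  linarith [hτ.traceSq_nonneg (x - y)]

theorem traceSq_sub_le (hτ : IsPositiveTrace τ) (x y : A) :
    traceSq τ (x - y) ≤ 2 * traceSq τ x + 2 * traceSq τ y := by
  rw [sub_eq_add_neg, ← traceSq_neg (τ := τ) y]
  exact hτ.traceSq_add_le x (-y)

theorem traceSq_smul [StarModule ℂ A] (c : ℂ) (x : A) :
    traceSq τ (c • x) = ‖c‖ ^ 2 * traceSq τ x := by
  have h : star c * c = ((‖c‖ ^ 2 : ℝ) : ℂ) := by
    rw [RCLike.star_def, ← Complex.normSq_eq_conj_mul_self, Complex.normSq_eq_norm_sq]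
  rw [traceSq, star_smul, smul_mul_smul_comm, map_smul, h, smul_eq_mul, Complex.re_ofReal_mul,
    traceSq]

theorem isTraceBounded_of_star (hτ : IsPositiveTrace τ) {C : ℝ} {a : A}
    (h : ∀ x, traceSq τ (a * x) ≤ C * traceSq τ x)
    (h' : ∀ x, traceSq τ (star a * x) ≤ C * traceSq τ x) : IsTraceBounded τ C a := by
  refine ⟨h, fun x => ?_⟩
  rw [← hτ.traceSq_star, star_mul, ← hτ.traceSq_star x]
  exact h' _

/-- An upper bound `a* a ≤ C`, witnessed by `C - a* a = w* w`, bounds left multiplication by `a`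
in the trace seminorm. -/
theorem traceSq_mul_le (hτ : IsPositiveTrace τ) {a w : A} {C : ℝ}
    (h : star a * a + star w * w = (C : ℂ) • (1 : A)) (x : A) :
    traceSq τ (a * x) ≤ C * traceSq τ x := by
  have h₁ : star (a * x) * (a * x) + star (w * x) * (w * x) = (C : ℂ) • (star x * x) := by
    have : star (a * x) * (a * x) + star (w * x) * (w * x)
        = star x * (star a * a + star w * w) * x := by
      simp only [star_mul]
      noncomm_ring
    rw [this, h, mul_smul_comm, mul_one, smul_mul_assoc]
  have h₂ : traceSq τ (a * x) + traceSq τ (w * x) = C * traceSq τ x := by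
    rw [traceSq, traceSq, ← Complex.add_re, ← map_add, h₁, map_smul, smul_eq_mul,
      Complex.re_ofReal_mul, traceSq]
  linarith [hτ.traceSq_nonneg (w * x)]

theorem isTraceBounded_of_isStarProjection [StarModule ℂ A] (hτ : IsPositiveTrace τ) {e : A}
    (he : IsStarProjection e) : IsTraceBounded τ 1 e := by
  have h (x : A) : traceSq τ (e * x) ≤ 1 * traceSq τ x := by
    refine hτ.traceSq_mul_le (w := 1 - e) ?_ x
    have h₁ : star e = e := he.isSelfAdjoint.star_eq
    have h₂ : e * e = e := he.isIdempotentElem.eq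
    simp only [star_sub, star_one, h₁, mul_sub, sub_mul, h₂, mul_one, one_mul]
    simp
  exact hτ.isTraceBounded_of_star h (by rw [he.isSelfAdjoint.star_eq]; exact h)

/-- The perturbation estimate for one half of `compressedCommutator`. -/
theorem traceSq_product_sub_le (hτ : IsPositiveTrace τ) {C : ℝ} (hC : 1 ≤ C) {a e x y : A}
    (ha : IsTraceBounded τ C a) (he : IsTraceBounded τ C e)
    (hx : IsTraceBounded τ 1 x) (hy : IsTraceBounded τ 1 y) :
    traceSq τ (a * x * a * y * a - e * x * e * y * e) ≤ 10 * C ^ 2 * traceSq τ (a - e) := by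
  have h₁ : traceSq τ ((a - e) * x * a * y * a) ≤ C ^ 2 * traceSq τ (a - e) := by
    have h1 := hx.right (a - e)
    have h2 := ha.right ((a - e) * x)
    have h3 := hy.right ((a - e) * x * a)
    have h4 := ha.right ((a - e) * x * a * y)
    have h5 : C * traceSq τ ((a - e) * x * a * y) ≤ C * (C * traceSq τ (a - e)) := by
      refine mul_le_mul_of_nonneg_left ?_ (by linarith)
      have : C * traceSq τ ((a - e) * x) ≤ C * traceSq τ (a - e) :=
        mul_le_mul_of_nonneg_left (by linarith) (by linarith)
      linarith
    linarith
  have h₂ : traceSq τ (e * x * (a - e) * y * a) ≤ C ^ 2 * traceSq τ (a - e) := by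
    have h1 := hx.left (a - e)
    have h2 := he.left (x * (a - e))
    have h3 := hy.right (e * (x * (a - e)))
    have h4 := ha.right (e * (x * (a - e)) * y)
    have h5 : C * traceSq τ (e * (x * (a - e)) * y) ≤ C * (C * traceSq τ (a - e)) := by
      refine mul_le_mul_of_nonneg_left ?_ (by linarith)
      have : C * traceSq τ (x * (a - e)) ≤ C * traceSq τ (a - e) :=
        mul_le_mul_of_nonneg_left (by linarith) (by linarith)
      linarith
    have h6 : e * x * (a - e) * y * a = e * (x * (a - e)) * y * a := by simp only [mul_assoc]
    rw [h6]
    linarith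
  have h₃ : traceSq τ (e * x * e * y * (a - e)) ≤ C ^ 2 * traceSq τ (a - e) := by
    have h1 := hy.left (a - e)
    have h2 := he.left (y * (a - e))
    have h3 := hx.left (e * (y * (a - e)))
    have h4 := he.left (x * (e * (y * (a - e))))
    have h5 : C * traceSq τ (x * (e * (y * (a - e)))) ≤ C * (C * traceSq τ (a - e)) := by
      refine mul_le_mul_of_nonneg_left ?_ (by linarith)
      have : C * traceSq τ (y * (a - e)) ≤ C * traceSq τ (a - e) :=
        mul_le_mul_of_nonneg_left (by linarith) (by linarith)
      linarith
    have h6 : e * x * e * y * (a - e) = e * (x * (e * (y * (a - e)))) := by simp only [mul_assoc]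
    rw [h6]
    linarith
  have h : a * x * a * y * a - e * x * e * y * e = (a - e) * x * a * y * a +
      (e * x * (a - e) * y * a + e * x * e * y * (a - e)) := by noncomm_ring
  rw [h]
  have h₄ := hτ.traceSq_add_le ((a - e) * x * a * y * a)
    (e * x * (a - e) * y * a + e * x * e * y * (a - e))
  have h₅ := hτ.traceSq_add_le (e * x * (a - e) * y * a) (e * x * e * y * (a - e))
  linarith

theorem traceSq_compressedCommutator_sub_le (hτ : IsPositiveTrace τ) {C : ℝ} (hC : 1 ≤ C)
    {a e x y : A} (ha : IsTraceBounded τ C a) (he : IsTraceBounded τ C e)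
    (hx : IsTraceBounded τ 1 x) (hy : IsTraceBounded τ 1 y) :
    traceSq τ (compressedCommutator a x y - compressedCommutator e x y) ≤
      40 * C ^ 2 * traceSq τ (a - e) := by
  have h : compressedCommutator a x y - compressedCommutator e x y =
      (a * x * a * y * a - e * x * e * y * e) - (a * y * a * x * a - e * y * e * x * e) := by
    simp only [compressedCommutator]
    abel
  rw [h]
  linarith [hτ.traceSq_sub_le (a * x * a * y * a - e * x * e * y * e)
    (a * y * a * x * a - e * y * e * x * e), hτ.traceSq_product_sub_le hC ha he hx hy,
    hτ.traceSq_product_sub_le hC ha he hy hx]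

/-- `compressedCommutator a x y` is bounded in the trace seminorm, uniformly in `x` and `y`. -/
theorem traceSq_compressedCommutator_le (hτ : IsPositiveTrace τ) {C : ℝ} (hC : 1 ≤ C) {a x y : A}
    (ha : IsTraceBounded τ C a) (hx : IsTraceBounded τ 1 x) (hy : IsTraceBounded τ 1 y) :
    traceSq τ (compressedCommutator a x y) ≤ 40 * C ^ 2 * traceSq τ a := by
  have h₀ : IsTraceBounded τ C (0 : A) :=
    ⟨fun x => by
      simpa [traceSq] using mul_nonneg (zero_le_one.trans hC) (hτ.traceSq_nonneg x), fun x => by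
      simpa [traceSq] using mul_nonneg (zero_le_one.trans hC) (hτ.traceSq_nonneg x)⟩
  have h := hτ.traceSq_compressedCommutator_sub_le hC ha h₀ hx hy
  simpa [compressedCommutator] using h

/-- If the compressed commutators of `e` vanish for one pair `x₀, y₀` that is nearly optimal for
a perturbation `a` of `e`, then those for every other pair are controlled by the distance
from `a` to `e`. -/
theorem traceSq_compressedCommutator_le_of_near (hτ : IsPositiveTrace τ) {C : ℝ} (hC : 1 ≤ C)
    {a e x y x₀ y₀ : A} (ha : IsTraceBounded τ C a) (he : IsTraceBounded τ C e)
    (hx : IsTraceBounded τ 1 x) (hy : IsTraceBounded τ 1 y)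
    (hx₀ : IsTraceBounded τ 1 x₀) (hy₀ : IsTraceBounded τ 1 y₀)
    (hopt : traceSq τ (compressedCommutator a x y) ≤
      2 * traceSq τ (compressedCommutator a x₀ y₀))
    (hzero : compressedCommutator e x₀ y₀ = 0) :
    traceSq τ (compressedCommutator e x y) ≤ 240 * C ^ 2 * traceSq τ (a - e) := by
  have h₁ := hτ.traceSq_compressedCommutator_sub_le hC ha he hx hy
  have h₂ := hτ.traceSq_compressedCommutator_sub_le hC ha he hx₀ hy₀
  rw [hzero, sub_zero] at h₂
  have h₃ := hτ.traceSq_sub_le (compressedCommutator a x y)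
    (compressedCommutator a x y - compressedCommutator e x y)
  rw [sub_sub_cancel] at h₃
  linarith

variable [StarModule ℂ A]

/-- The resolvent `(1 + i x)⁻¹` of a self-adjoint element is a contraction. -/
theorem isTraceBounded_resolvent (hτ : IsPositiveTrace τ) {x r : A} (hx : IsSelfAdjoint x)
    (hr : (1 + Complex.I • x) * r = 1) (hr' : r * (1 + Complex.I • x) = 1) :
    IsTraceBounded τ 1 r := by
  have key (y s : A) (hy : IsSelfAdjoint y) (hs : (1 + Complex.I • y) * s = 1) (z : A) :
      traceSq τ (s * z) ≤ 1 * traceSq τ z := by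
    refine hτ.traceSq_mul_le (w := y * s) ?_ z
    have h : star s * (star (1 + Complex.I • y) * (1 + Complex.I • y)) * s = 1 := by
      have h' := congrArg star hs
      rw [star_mul, star_one] at h'
      rw [← mul_assoc, h', one_mul, hs]
    have h₂ : star (1 + Complex.I • y) * (1 + Complex.I • y) = 1 + y * y := by
      simp only [star_add, star_one, star_smul, hy.star_eq, RCLike.star_def, Complex.conj_I]
      simp only [add_mul, mul_add, one_mul, mul_one, smul_mul_smul_comm]
      simp
    rw [h₂] at h
    rw [star_mul, hy.star_eq, Complex.ofReal_one, one_smul, ← h]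
    noncomm_ring
  refine hτ.isTraceBounded_of_star (key x r hx hr) (key (-x) (star r) hx.neg ?_)
  have h := congrArg star hr'
  rw [star_mul] at h
  simpa [hx.star_eq] using h

/-- For the resolvent `r = (1 + i x)⁻¹`, the element `(1 - i)(1 - r)` is a bounded function of `x`
that fixes projections, as its values at `0` and `1` are `0` and `1`. -/
theorem isTraceBounded_one_sub_resolvent (hτ : IsPositiveTrace τ) {r : A}
    (hr : IsTraceBounded τ 1 r) : IsTraceBounded τ 8 ((1 - Complex.I) • (1 - r)) := by
  have hn : ‖(1 - Complex.I : ℂ)‖ ^ 2 = 2 := by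
    rw [← Complex.normSq_eq_norm_sq]
    simp [Complex.normSq_apply]
    norm_num
  constructor <;> intro x
  · rw [smul_mul_assoc, traceSq_smul, hn, sub_mul, one_mul]
    linarith [hτ.traceSq_sub_le x (r * x), hr.left x]
  · rw [mul_smul_comm, traceSq_smul, hn, mul_sub, mul_one]
    linarith [hτ.traceSq_sub_le x (x * r), hr.right x]

/-- The function of `isTraceBounded_one_sub_resolvent` is Lipschitz at projections, by the resolvent
identity. -/
theorem traceSq_one_sub_resolvent_sub_le (hτ : IsPositiveTrace τ) {x e r : A}
    (hr' : r * (1 + Complex.I • x) = 1)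
    (hrb : IsTraceBounded τ 1 r) (he : IsStarProjection e) :
    traceSq τ ((1 - Complex.I) • (1 - r) - e) ≤ 2 * traceSq τ (x - e) := by
  have hee : e * e = e := he.isIdempotentElem.eq
  -- The resolvent `(1 + i e)⁻¹` of the projection `e`.
  set s : A := 1 - ((1 + Complex.I) / 2) • e with hs
  have hs₁ : (1 + Complex.I • e) * s = 1 := by
    simp only [hs, mul_sub, mul_one, mul_smul_comm, add_mul, one_mul, smul_mul_assoc, hee]
    rw [smul_add, smul_smul, add_sub_assoc, ← sub_sub, ← sub_smul, ← sub_smul,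
      show (Complex.I - (1 + Complex.I) / 2 - (1 + Complex.I) / 2 * Complex.I : ℂ) = 0 by
        linear_combination (-1 / 2 : ℂ) * Complex.I_sq]
    simp
  have hs₂ : s * (1 + Complex.I • e) = 1 := by
    have hcomm : Commute s (1 + Complex.I • e) := by
      refine Commute.add_right (Commute.one_right _) (Commute.smul_right ?_ _)
      exact (Commute.one_left e).sub_left ((Commute.refl e).smul_left _)
    rw [hcomm.eq, hs₁]
  have hsb := hτ.isTraceBounded_resolvent he.isSelfAdjoint hs₁ hs₂
  have hes : (1 - Complex.I) • (1 - s) = e := by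
    rw [hs, sub_sub_cancel, smul_smul,
      show ((1 - Complex.I) * ((1 + Complex.I) / 2) : ℂ) = 1 by
        linear_combination (-1 / 2 : ℂ) * Complex.I_sq, one_smul]
  have hres : s - r = Complex.I • (r * (x - e) * s) := by
    have h₁ : r * ((1 + Complex.I • x) - (1 + Complex.I • e)) * s = s - r := by
      rw [mul_sub r, hr', sub_mul, one_mul, mul_assoc, hs₁, mul_one]
    rw [← h₁, add_sub_add_left_eq_sub, ← smul_sub, mul_smul_comm, smul_mul_assoc]
  have h : (1 - Complex.I) • (1 - r) - e =
      ((1 - Complex.I) * Complex.I) • (r * (x - e) * s) := by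
    nth_rewrite 1 [← hes]
    rw [← smul_sub, sub_sub_sub_cancel_left, hres, smul_smul]
  have hn : ‖((1 - Complex.I) * Complex.I : ℂ)‖ ^ 2 = 2 := by
    rw [← Complex.normSq_eq_norm_sq]
    simp [Complex.normSq_apply]
    norm_num
  rw [h, traceSq_smul, hn]
  linarith [hsb.right (r * (x - e)), hrb.left (x - e)]

/-- The self-adjoint part of `x` is at least as close to a self-adjoint element as `x`. This uses
that the adjoint preserves the trace seminorm. -/
theorem traceSq_selfAdjointPart_sub_le (hτ : IsPositiveTrace τ) {x e : A}
    (he : IsSelfAdjoint e) :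
    traceSq τ ((1 / 2 : ℂ) • (x + star x) - e) ≤ traceSq τ (x - e) := by
  have h : (1 / 2 : ℂ) • (x + star x) - e = (1 / 2 : ℂ) • ((x - e) + star (x - e)) := by
    have h2 : e = (1 / 2 : ℂ) • (e + e) := by
      rw [← two_smul ℂ e, smul_smul]
      norm_num
    nth_rewrite 1 [h2]
    rw [← smul_sub, star_sub, he.star_eq]
    congr 1
    abel
  rw [h, traceSq_smul]
  have h₁ := hτ.traceSq_add_le (x - e) (star (x - e))
  rw [hτ.traceSq_star] at h₁
  rw [show ‖(1 / 2 : ℂ)‖ ^ 2 = 1 / 4 by norm_num]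
  linarith

end IsPositiveTrace

end TraceSq

namespace VonNeumannAlgebra

variable {H : Type*} [NormedAddCommGroup H] [InnerProductSpace ℂ H] [CompleteSpace H]
  {M : VonNeumannAlgebra H}

/-! ### Square roots and resolvents inside a von Neumann algebra -/

theorem mem_of_forall_commute {x : H →L[ℂ] H}
    (h : ∀ y ∈ Set.centralizer (M : Set (H →L[ℂ] H)), Commute y x) : x ∈ M := by
  rw [← SetLike.mem_coe, ← M.centralizer_centralizer, Set.mem_centralizer_iff]
  exact h

theorem exists_star_mul_self_add_eq (a : M.toStarSubalgebra) {C : ℝ}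
    (ha : ‖(a : H →L[ℂ] H)‖ ^ 2 ≤ C) :
    ∃ w : M.toStarSubalgebra, star a * a + star w * w = (C : ℂ) • 1 := by
  set b : H →L[ℂ] H := (C : ℂ) • 1 - star (a : H →L[ℂ] H) * a with hb
  have hb0 : 0 ≤ b := by
    rw [hb, sub_nonneg]
    refine CStarAlgebra.star_mul_le_algebraMap_norm_sq.trans ?_
    have : (C : ℂ) • (1 : H →L[ℂ] H) = algebraMap ℝ (H →L[ℂ] H) C := by
      rw [Algebra.algebraMap_eq_smul_one]
      exact Complex.coe_smul C _
    rw [this]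
    exact algebraMap_mono _ ha
  have hwM : CFC.sqrt b ∈ M := by
    refine mem_of_forall_commute fun y hy => ?_
    have hyb : Commute b y := by
      have h₁ : Commute (star (a : H →L[ℂ] H) * a) y :=
        Set.mem_centralizer_iff.1 hy _ (mul_mem (star_mem a.2) a.2)
      exact ((Commute.one_left y).smul_left _).sub_left h₁
    exact (hyb.cfcₙ_nnreal _).symm
  refine ⟨⟨CFC.sqrt b, hwM⟩, Subtype.ext ?_⟩
  change star (a : H →L[ℂ] H) * a + star (CFC.sqrt b) * CFC.sqrt b = (C : ℂ) • 1
  rw [(CFC.sqrt_nonneg b).isSelfAdjoint.star_eq, CFC.sqrt_mul_sqrt_self b, hb]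
  abel

theorem exists_resolvent {x : M.toStarSubalgebra} (hx : IsSelfAdjoint x) :
    ∃ r : M.toStarSubalgebra,
      (1 + Complex.I • x) * r = 1 ∧ r * (1 + Complex.I • x) = 1 := by
  have hx' : IsSelfAdjoint (x : H →L[ℂ] H) := congrArg Subtype.val hx
  have hu : IsUnit (1 + Complex.I • (x : H →L[ℂ] H)) := by
    have h₁ : Complex.I ∉ spectrum ℂ (x : H →L[ℂ] H) := fun h => by
      have := congrArg Complex.im (hx'.mem_spectrum_eq_re h)
      simp at this
    rw [spectrum.notMem_iff] at h₁
    have h₂ : 1 + Complex.I • (x : H →L[ℂ] H) = (-Complex.I) •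
        (algebraMap ℂ (H →L[ℂ] H) Complex.I - x) := by
      rw [Algebra.algebraMap_eq_smul_one, smul_sub, smul_smul]
      simp
    rw [h₂]
    exact h₁.smul (Units.mk0 (-Complex.I) (by simp))
  have hrM : ((hu.unit⁻¹ : (H →L[ℂ] H)ˣ) : H →L[ℂ] H) ∈ M := by
    refine mem_of_forall_commute fun y hy => ?_
    have hyx : Commute (x : H →L[ℂ] H) y := Set.mem_centralizer_iff.1 hy _ x.2
    refine Commute.units_inv_right ?_
    exact ((Commute.one_left y).add_left (hyx.smul_left _)).symm
  exact ⟨⟨_, hrM⟩, ⟨Subtype.ext hu.mul_val_inv, Subtype.ext hu.val_inv_mul⟩⟩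

/-! ### Normal traces -/

section Trace

variable {τ : M.toStarSubalgebra →ₗ[ℂ] ℂ}

theorem IsFaithfulNormalTrace.isPositiveTrace (hτ : M.IsFaithfulNormalTrace τ) :
    IsPositiveTrace τ := ⟨hτ.map_mul_comm, hτ.nonneg⟩

theorem IsFaithfulNormalTrace.eq_zero_of_traceSq_eq_zero (hτ : M.IsFaithfulNormalTrace τ)
    {x : M.toStarSubalgebra} (hx : traceSq τ x = 0) : x = 0 := by
  refine hτ.faithful x ?_
  rw [hτ.isPositiveTrace.map_star_mul_self, hx, Complex.ofReal_zero]

theorem _root_.IsPositiveTrace.isTraceBounded_of_norm_le_one (hτ : IsPositiveTrace τ)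
    {a : M.toStarSubalgebra} (ha : ‖(a : H →L[ℂ] H)‖ ≤ 1) : IsTraceBounded τ 1 a := by
  have key (b : M.toStarSubalgebra) (hb : ‖(b : H →L[ℂ] H)‖ ≤ 1) (x : M.toStarSubalgebra) :
      traceSq τ (b * x) ≤ 1 * traceSq τ x := by
    obtain ⟨w, hw⟩ := exists_star_mul_self_add_eq b (C := 1) (pow_le_one₀ (norm_nonneg _) hb)
    exact hτ.traceSq_mul_le hw x
  exact hτ.isTraceBounded_of_star (key a ha)
    (key (star a) (by change ‖star (a : H →L[ℂ] H)‖ ≤ 1; rwa [norm_star]))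

theorem IsFaithfulNormalTrace.exists_finset (hτ : M.IsFaithfulNormalTrace τ) {ε : ℝ}
    (hε : 0 < ε) :
    ∃ F : Finset (lp (fun _ : ℕ => H) 2 × lp (fun _ : ℕ => H) 2), ∃ δ > 0,
      ∀ x : M.toStarSubalgebra,
        (∀ p ∈ F, ‖⟪p.2, amplify (x : H →L[ℂ] H) p.1⟫_ℂ‖ < δ) → ‖τ x‖ < ε := by
  have h := (@continuous_iff_continuousAt _ _ (_) _ _).1 hτ.normal 0
  have h₁ := h (Metric.ball_mem_nhds (τ 0) hε)
  rw [Filter.mem_map, @nhds_induced _ _ (ultraweakTopology H), Filter.mem_comap] at h₁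
  obtain ⟨U, hU, hUτ⟩ := h₁
  obtain ⟨F, δ, hδ, hF⟩ := exists_finset_of_mem_nhds_ultraweak hU
  refine ⟨F, δ, hδ, fun x hx => ?_⟩
  have hxU : (x : H →L[ℂ] H) ∈ U := hF _ fun p hp => by
    have h0 : (x : H →L[ℂ] H) - ((0 : M.toStarSubalgebra) : H →L[ℂ] H) = x := sub_zero _
    rw [h0]
    exact hx p hp
  simpa using hUτ hxU

/-- A faithful normal trace yields a countable family of vectors separating the algebra: the
components of the vectors occurring in a basic ultraweak neighbourhood on which `τ` is small. -/
theorem IsFaithfulNormalTrace.exists_countable_separating (hτ : M.IsFaithfulNormalTrace τ) :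
    ∃ Ω : Set H, Ω.Countable ∧ ∀ x ∈ M, (∀ ω ∈ Ω, x ω = 0) → x = 0 := by
  obtain ⟨F, δ, hδ, hF⟩ := hτ.exists_finset one_pos
  refine ⟨⋃ p ∈ F, Set.range fun n => p.1 n,
    F.countable_toSet.biUnion fun p _ => Set.countable_range _, fun x hx h0 => ?_⟩
  let X : M.toStarSubalgebra := ⟨x, hx⟩
  have hsmall (c : ℂ) : ‖τ (c • (star X * X))‖ < 1 := by
    refine hF _ fun p hp => ?_
    have : amplify ((c • (star X * X) : M.toStarSubalgebra) : H →L[ℂ] H) p.1 = 0 := by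
      refine lp.ext (funext fun n => ?_)
      have hxn : x (p.1 n) = 0 := h0 _ (Set.mem_biUnion hp ⟨n, rfl⟩)
      change c • (star x (x (p.1 n))) = 0
      rw [hxn, map_zero, smul_zero]
    rw [this, inner_zero_right, norm_zero]
    exact hδ
  have hzero : τ (star X * X) = 0 := by
    by_contra hne
    have h1 := hsmall (τ (star X * X))⁻¹
    rw [map_smul, smul_eq_mul, inv_mul_cancel₀ hne, norm_one] at h1
    exact lt_irrefl _ h1
  exact congrArg Subtype.val (hτ.faithful X hzero)

theorem IsFaithfulNormalTrace.exists_traceSq_sub_lt (hτ : M.IsFaithfulNormalTrace τ)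
    {T : Set M.toStarSubalgebra}
    (hT : IsDenseScalarStarAlgebra ((↑) '' T : Set (H →L[ℂ] H))) {x : M.toStarSubalgebra}
    (hx : (x : H →L[ℂ] H) ∈ generatedBy ((↑) '' T : Set (H →L[ℂ] H))) {ε : ℝ} (hε : 0 < ε) :
    ∃ t ∈ T, traceSq τ (t - x) < ε := by
  obtain ⟨F, δ, hδ, hF⟩ := hτ.exists_finset hε
  rw [← SetLike.mem_coe, coe_generatedBy_of_star_mem hT.star_mem] at hx
  obtain ⟨-, ⟨t, ht, rfl⟩, hlt⟩ := exists_amplify_sub_lt hT hx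
    (Sum.elim (fun p : F => p.1.1) (fun p : F => p.1.2)) (Real.sqrt_pos.2 hδ)
  refine ⟨t, ht, ?_⟩
  have h : ‖τ (star (t - x) * (t - x))‖ < ε := by
    refine hF _ fun p hp => ?_
    have h₁ := hlt (Sum.inl ⟨p, hp⟩)
    have h₂ := hlt (Sum.inr ⟨p, hp⟩)
    simp only [Sum.elim_inl, Sum.elim_inr] at h₁ h₂
    have h₃ : amplify ((star (t - x) * (t - x) : M.toStarSubalgebra) : H →L[ℂ] H) p.1 =
        amplify (star ((t : H →L[ℂ] H) - (x : H →L[ℂ] H)))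
          (amplify ((t : H →L[ℂ] H) - (x : H →L[ℂ] H)) p.1) :=
      amplify_mul _ _ _
    rw [h₃, ← inner_amplify_left]
    calc _ ≤ ‖amplify ((t : H →L[ℂ] H) - (x : H →L[ℂ] H)) p.2‖ *
            ‖amplify ((t : H →L[ℂ] H) - (x : H →L[ℂ] H)) p.1‖ :=
          norm_inner_le_norm _ _
      _ < √δ * √δ := mul_lt_mul'' h₂ h₁ (norm_nonneg _) (norm_nonneg _)
      _ = δ := Real.mul_self_sqrt hδ.le
  exact (le_abs_self _).trans_lt ((Complex.abs_re_le_norm _).trans_lt h)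

end Trace

end VonNeumannAlgebra

/-! ### Separable subalgebras of type II₁ -/

theorem exists_forall_le_two_mul {β : Type*} [Nonempty β] {f : β → ℝ} (h0 : ∀ b, 0 ≤ f b)
    (hf : BddAbove (Set.range f)) : ∃ b₀, ∀ b, f b ≤ 2 * f b₀ := by
  by_cases hpos : 0 < ⨆ b, f b
  · obtain ⟨b₀, hb₀⟩ := exists_lt_of_lt_ciSup (half_lt_self hpos)
    exact ⟨b₀, fun b => by linarith [le_ciSup hf b]⟩
  · exact ⟨Classical.arbitrary β, fun b => by
      linarith [le_ciSup hf b, h0 (Classical.arbitrary β)]⟩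

namespace VonNeumannAlgebra

variable {H : Type*} [NormedAddCommGroup H] [InnerProductSpace ℂ H] [CompleteSpace H]
  {M : VonNeumannAlgebra H} {τ : M.toStarSubalgebra →ₗ[ℂ] ℂ}

/-- The supremum over all contractions of `M` need not be attained; the factor `2` leaves room. -/
theorem exists_nearly_maximal_compressedCommutator (hτ : IsPositiveTrace τ) {C : ℝ} (hC : 1 ≤ C)
    {a : M.toStarSubalgebra} (ha : IsTraceBounded τ C a) :
    ∃ x₀ y₀ : M.toStarSubalgebra, ‖(x₀ : H →L[ℂ] H)‖ ≤ 1 ∧ ‖(y₀ : H →L[ℂ] H)‖ ≤ 1 ∧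
      ∀ x y : M.toStarSubalgebra, ‖(x : H →L[ℂ] H)‖ ≤ 1 → ‖(y : H →L[ℂ] H)‖ ≤ 1 →
        traceSq τ (compressedCommutator a x y) ≤
          2 * traceSq τ (compressedCommutator a x₀ y₀) := by
  let B := {x : M.toStarSubalgebra // ‖(x : H →L[ℂ] H)‖ ≤ 1}
  have : Nonempty B := ⟨⟨0, by change ‖(0 : H →L[ℂ] H)‖ ≤ 1; simp⟩⟩
  obtain ⟨⟨x₀, y₀⟩, h⟩ := exists_forall_le_two_mul
    (f := fun p : B × B => traceSq τ (compressedCommutator a p.1.1 p.2.1))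
    (fun p => hτ.traceSq_nonneg _)
    ⟨40 * C ^ 2 * traceSq τ a, by
      rintro - ⟨p, rfl⟩
      exact hτ.traceSq_compressedCommutator_le hC ha (hτ.isTraceBounded_of_norm_le_one p.1.2)
        (hτ.isTraceBounded_of_norm_le_one p.2.2)⟩
  exact ⟨x₀.1, y₀.1, x₀.2, y₀.2, fun x y hx hy => h (⟨x, hx⟩, ⟨y, hy⟩)⟩

theorem compressedCommutator_smul_smul (a x y : M.toStarSubalgebra) (c d : ℂ) :
    compressedCommutator a (c • x) (d • y) = (c * d) • compressedCommutator a x y := by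
  simp only [compressedCommutator, mul_smul_comm, smul_mul_assoc, smul_smul, smul_sub,
    mul_comm d c]

/-- Abelian projections are detected by contractions, since the commutator is bilinear. -/
theorem isAbelianProjection_of_compressedCommutator {e : M.toStarSubalgebra}
    (he : IsStarProjection (e : H →L[ℂ] H))
    (h : ∀ x y : M.toStarSubalgebra, ‖(x : H →L[ℂ] H)‖ ≤ 1 → ‖(y : H →L[ℂ] H)‖ ≤ 1 →
      compressedCommutator e x y = 0) : M.IsAbelianProjection (e : H →L[ℂ] H) := by
  have hscale (x : M.toStarSubalgebra) : ∃ c : ℂ, c ≠ 0 ∧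
      ‖((c • x : M.toStarSubalgebra) : H →L[ℂ] H)‖ ≤ 1 := by
    refine ⟨((‖(x : H →L[ℂ] H)‖ + 1)⁻¹ : ℝ), ?_, ?_⟩
    · exact Complex.ofReal_ne_zero.2 (inv_ne_zero (by positivity))
    · change ‖(((‖(x : H →L[ℂ] H)‖ + 1)⁻¹ : ℝ) : ℂ) • (x : H →L[ℂ] H)‖ ≤ 1
      rw [norm_smul, Complex.norm_real, norm_inv, Real.norm_of_nonneg (by positivity),
        inv_mul_le_iff₀ (by positivity)]
      linarith
  refine ⟨e.2, he, fun x hx y hy => ?_⟩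
  obtain ⟨c, hc, hcx⟩ := hscale ⟨x, hx⟩
  obtain ⟨d, hd, hdy⟩ := hscale ⟨y, hy⟩
  have h₁ := h _ _ hcx hdy
  rw [compressedCommutator_smul_smul, smul_eq_zero, or_iff_right (mul_ne_zero hc hd)] at h₁
  rw [compressedCommutator_eq (Subtype.ext he.isIdempotentElem.eq)] at h₁
  exact sub_eq_zero.1 (congrArg Subtype.val h₁)

/-- Every element `t` gives a bounded element whose squared distance to each projection is at most
twice that of `t`. -/
theorem exists_isTraceBounded_approximant (hτ : IsPositiveTrace τ) (t : M.toStarSubalgebra) :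
    ∃ a : M.toStarSubalgebra, IsTraceBounded τ 8 a ∧ ∀ e : M.toStarSubalgebra,
      IsStarProjection e → traceSq τ (a - e) ≤ 2 * traceSq τ (t - e) := by
  have hsa : IsSelfAdjoint ((1 / 2 : ℂ) • (t + star t)) := by
    have h₁ : IsSelfAdjoint (1 / 2 : ℂ) := by simp [isSelfAdjoint_iff]
    exact h₁.smul (.add_star_self t)
  obtain ⟨r, hr, hr'⟩ := exists_resolvent hsa
  have hrb := hτ.isTraceBounded_resolvent hsa hr hr'
  refine ⟨_, hτ.isTraceBounded_one_sub_resolvent hrb, fun e he => ?_⟩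
  linarith [hτ.traceSq_one_sub_resolvent_sub_le hr' hrb he,
    hτ.traceSq_selfAdjointPart_sub_le (x := t) he.isSelfAdjoint]

/-- A downward Löwenheim–Skolem argument: the countable set generating `M₀` is closed under
taking, for each of its elements `t`, a nearly optimal pair of contractions of `M` witnessing that
a certain bounded element `a t` built from `t` is far from being abelian. A projection `e` of `M₀` is
a limit of such `a t` in the trace seminorm, so if `e` is abelian in `M₀` then it is abelian
in `M`. -/
theorem exists_separable_isTypeII1 (hM : M.IsTypeII1) (hτ : M.IsFaithfulNormalTrace τ)
    {S : Set (H →L[ℂ] H)} (hS : S.Countable) (hSM : S ⊆ (M : Set (H →L[ℂ] H))) :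
    ∃ M₀ : VonNeumannAlgebra H, M₀ ≤ M ∧ S ⊆ (M₀ : Set (H →L[ℂ] H)) ∧ M₀.IsTypeII1 ∧
      M₀.IsSeparable := by
  have hp := hτ.isPositiveTrace
  choose a ha hae using exists_isTraceBounded_approximant (M := M) hp
  choose w₁ w₂ hw₁ hw₂ hw using fun x =>
    exists_nearly_maximal_compressedCommutator hp (by norm_num) (ha x)
  -- The unary operations ignore their second argument.
  let F : ℕ ⊕ Fin 5 → M.toStarSubalgebra → M.toStarSubalgebra → M.toStarSubalgebra :=
    Sum.elim (fun n x _ => TopologicalSpace.denseSeq ℂ n • x)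
      ![fun x y => x + y, fun x y => x * y, fun x _ => star x, fun x _ => w₁ x, fun x _ => w₂ x]
  have hS' : (insert 1 (Subtype.val ⁻¹' S) : Set M.toStarSubalgebra).Countable :=
    (hS.preimage Subtype.val_injective).insert 1
  obtain ⟨T, hTc, hST, hT⟩ := hS'.exists_countable_closed F
  have hTalg : IsDenseScalarStarAlgebra ((↑) '' T : Set (H →L[ℂ] H)) := by
    refine ⟨⟨1, hST (Set.mem_insert _ _), rfl⟩, ?_, ?_, ?_, ?_⟩
    · rintro - ⟨x, hx, rfl⟩ - ⟨y, hy, rfl⟩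
      exact ⟨x + y, hT (Sum.inr 0) x hx y hy, rfl⟩
    · rintro - ⟨x, hx, rfl⟩ - ⟨y, hy, rfl⟩
      exact ⟨x * y, hT (Sum.inr 1) x hx y hy, rfl⟩
    · rintro - ⟨x, hx, rfl⟩
      exact ⟨star x, hT (Sum.inr 2) x hx x hx, rfl⟩
    · refine (TopologicalSpace.denseRange_denseSeq ℂ).mono ?_
      rintro - ⟨n, rfl⟩ - ⟨x, hx, rfl⟩
      exact ⟨TopologicalSpace.denseSeq ℂ n • x, hT (Sum.inl n) x hx x hx, rfl⟩
  have hle : generatedBy ((↑) '' T : Set (H →L[ℂ] H)) ≤ M := by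
    refine generatedBy_le ?_
    rintro - ⟨x, -, rfl⟩
    exact x.2
  have hmem {x : M.toStarSubalgebra} (hx : x ∈ T) :
      (x : H →L[ℂ] H) ∈ generatedBy ((↑) '' T : Set (H →L[ℂ] H)) :=
    subset_generatedBy _ ⟨x, hx, rfl⟩
  have hSM₀ : S ⊆ (generatedBy ((↑) '' T : Set (H →L[ℂ] H)) : Set (H →L[ℂ] H)) := fun x hx =>
    hmem (x := ⟨x, hSM hx⟩) (hST (Set.mem_insert_of_mem _ hx))
  have hfin : (generatedBy ((↑) '' T : Set (H →L[ℂ] H))).IsFinite := fun v hv => hM.1 v (hle hv)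
  refine ⟨_, hle, hSM₀, ⟨hfin, ?_⟩, isSeparable_generatedBy hTalg (hTc.image _)⟩
  rintro e ⟨heM₀, he, hab⟩
  refine hM.2 e ?_
  let E : M.toStarSubalgebra := ⟨e, hle heM₀⟩
  have hE : IsStarProjection E :=
    ⟨Subtype.ext he.isIdempotentElem.eq, Subtype.ext he.isSelfAdjoint.star_eq⟩
  have hEb : IsTraceBounded τ 8 E := by
    have h := hp.isTraceBounded_of_isStarProjection hE
    exact ⟨fun x => (h.left x).trans (by linarith [hp.traceSq_nonneg x]),
      fun x => (h.right x).trans (by linarith [hp.traceSq_nonneg x])⟩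
  refine isAbelianProjection_of_compressedCommutator (e := E) he fun x y hx hy => ?_
  refine hτ.eq_zero_of_traceSq_eq_zero (le_antisymm ?_ (hp.traceSq_nonneg _))
  refine le_of_forall_pos_le_add fun ε hε => ?_
  obtain ⟨t, ht, hlt⟩ := hτ.exists_traceSq_sub_lt hTalg (x := E) heM₀
    (ε := ε / (240 * 8 ^ 2 * 2)) (by positivity)
  have hw₁T : w₁ t ∈ T := hT (Sum.inr 3) t ht t ht
  have hw₂T : w₂ t ∈ T := hT (Sum.inr 4) t ht t ht
  have hzero : compressedCommutator E (w₁ t) (w₂ t) = 0 := by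
    rw [compressedCommutator_eq hE.isIdempotentElem]
    exact Subtype.ext (sub_eq_zero.2 (hab _ (hmem hw₁T) _ (hmem hw₂T)))
  have h₁ := hp.traceSq_compressedCommutator_le_of_near (by norm_num) (ha t) hEb
    (hp.isTraceBounded_of_norm_le_one hx) (hp.isTraceBounded_of_norm_le_one hy)
    (hp.isTraceBounded_of_norm_le_one (hw₁ t)) (hp.isTraceBounded_of_norm_le_one (hw₂ t))
    (hw t x y hx hy) hzero
  have h₂ := hae t E hE
  rw [lt_div_iff₀ (by positivity)] at hlt
  linarith

end VonNeumannAlgebra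

/-! ### Strong-* approximation -/

theorem isDenseScalarStarAlgebra_span {A : Type*} [Ring A] [StarRing A] [Algebra ℂ A]
    [StarModule ℂ A] {G : Set A} (hone : 1 ∈ G) (hmul : ∀ x ∈ G, ∀ y ∈ G, x * y ∈ G)
    (hstar : ∀ x ∈ G, star x ∈ G) :
    IsDenseScalarStarAlgebra (Submodule.span ℂ G : Set A) := by
  refine ⟨Submodule.subset_span hone, fun x hx y hy => Submodule.add_mem _ hx hy,
    fun x hx y hy => ?_, fun x hx => ?_, ?_⟩
  · have h := Submodule.mul_mem_mul hx hy
    rw [Submodule.span_mul_span] at h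
    exact Submodule.span_mono (Set.mul_subset_iff.2 hmul) h
  · refine Submodule.span_induction (p := fun x _ => star x ∈ Submodule.span ℂ G)
      (fun x hx => Submodule.subset_span (hstar x hx)) ?_ ?_ ?_ hx
    · rw [star_zero]
      exact Submodule.zero_mem _
    · intro x y _ _ hx hy
      rw [star_add]
      exact Submodule.add_mem _ hx hy
    · intro c x _ hx
      rw [star_smul]
      exact Submodule.smul_mem _ _ hx
  · convert dense_univ
    exact Set.eq_univ_of_forall fun c x hx => Submodule.smul_mem _ c hx

section StrongStar

variable {H : Type*} [NormedAddCommGroup H] [InnerProductSpace ℂ H] [CompleteSpace H]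

/-- A real subspace of a complex Hilbert space is determined, up to closure, by the real parts of
the inner products with the vectors orthogonal to it. -/
theorem mem_closure_of_re_inner_eq_zero {S : Set H} (hne : S.Nonempty)
    (hadd : ∀ v ∈ S, ∀ w ∈ S, v + w ∈ S) (hsmul : ∀ c : ℝ, ∀ v ∈ S, (c : ℂ) • v ∈ S) {x : H}
    (h : ∀ w, (∀ v ∈ S, (⟪w, v⟫_ℂ).re = 0) → (⟪w, x⟫_ℂ).re = 0) : x ∈ closure S := by
  have hsmul' (c : ℝ) {v : H} (hv : v ∈ S) : c • v ∈ S := by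
    simpa using hsmul c v hv
  let : InnerProductSpace ℝ H := InnerProductSpace.complexToReal
  let K : Submodule ℝ H :=
    { carrier := S
      add_mem' := fun hv hw => hadd _ hv _ hw
      zero_mem' := by
        obtain ⟨v, hv⟩ := hne
        simpa using hsmul' 0 hv
      smul_mem' := fun c _ hv => hsmul' c hv }
  have hK : x ∈ Kᗮᗮ := by
    rw [Submodule.mem_orthogonal]
    intro w hw
    rw [real_inner_eq_re_inner ℂ]
    refine h w fun v hv => ?_
    have := (Submodule.mem_orthogonal' K w).1 hw v hv
    rwa [real_inner_eq_re_inner ℂ] at this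
  rw [Submodule.orthogonal_orthogonal_eq_closure] at hK
  exact hK

theorem mem_closure_image_prod {T : Set (H →L[ℂ] H)} (hT : IsDenseScalarStarAlgebra T)
    {x : H →L[ℂ] H} (hx : x ∈ Set.centralizer (Set.centralizer T)) (u v : H) :
    (x u, x v) ∈ closure ((fun t : H →L[ℂ] H => (t u, t v)) '' T) := by
  -- Both vectors are approximated at once by amplifying to two copies of `H`.
  let ξ : lp (fun _ : Bool => H) 2 :=
    ⟨fun b => if b then u else v, memℓp_gen Summable.of_finite⟩
  have hcont (b : Bool) : Continuous fun ζ : lp (fun _ : Bool => H) 2 => ζ b :=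
    (lp.lipschitzWith_one_eval 2 b).continuous
  refine map_mem_closure (f := fun ζ : lp (fun _ : Bool => H) 2 => (ζ true, ζ false))
    ((hcont true).prodMk (hcont false))
    (amplify_mem_closure_of_mem_doubleCommutant hT hx ξ) ?_
  rintro - ⟨t, ht, rfl⟩
  exact ⟨t, ht, rfl⟩

/-- Strong-* density. The approximants of a complex `*`-algebra form a real subspace of `H × H`;
its closure is detected by real-linear functionals, and these only involve the
weak operator topology, in which the adjoint is continuous. -/
theorem mem_closure_image_star {W : Submodule ℂ (H →L[ℂ] H)}
    (hW : IsDenseScalarStarAlgebra (W : Set (H →L[ℂ] H))) {x : H →L[ℂ] H}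
    (hx : x ∈ Set.centralizer (Set.centralizer (W : Set (H →L[ℂ] H)))) (u v : H) :
    (x u, star x v) ∈ closure ((fun t : H →L[ℂ] H => (t u, star t v)) '' W) := by
  let E := WithLp 2 (H × H)
  let f (t : H →L[ℂ] H) : E := WithLp.toLp 2 (t u, star t v)
  have key : f x ∈ closure (f '' W) := by
    refine mem_closure_of_re_inner_eq_zero (Set.Nonempty.image f ⟨0, W.zero_mem⟩) ?_ ?_
      fun w hw => ?_
    · rintro - ⟨s, hs, rfl⟩ - ⟨t, ht, rfl⟩
      refine ⟨s + t, W.add_mem hs ht, ?_⟩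
      simp only [f, star_add, add_apply]
      rfl
    · rintro c - ⟨t, ht, rfl⟩
      refine ⟨(c : ℂ) • t, W.smul_mem _ ht, ?_⟩
      simp only [f, star_smul, RCLike.star_def, Complex.conj_ofReal]
      rfl
    · have hf (t : H →L[ℂ] H) : ⟪w, f t⟫_ℂ = ⟪w.fst, t u⟫_ℂ + ⟪t w.snd, v⟫_ℂ := by
        rw [← ContinuousLinearMap.adjoint_inner_right, ← ContinuousLinearMap.star_eq_adjoint]
        exact WithLp.prod_inner_apply _ _
      have hcl : IsClosed {p : H × H | (⟪w.fst, p.1⟫_ℂ + ⟪p.2, v⟫_ℂ).re = 0} :=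
        isClosed_eq (by fun_prop) continuous_const
      have h := closure_minimal (fun p hp => ?_) hcl (mem_closure_image_prod hW hx u w.snd)
      · rw [hf]
        exact h
      · obtain ⟨t, ht, rfl⟩ := hp
        have := hw (f t) ⟨t, ht, rfl⟩
        rwa [hf] at this
  refine map_mem_closure (f := fun p : E => (p.fst, p.snd)) (by fun_prop) key ?_
  rintro - ⟨t, ht, rfl⟩
  exact ⟨t, ht, rfl⟩

end StrongStar

/-! ### Cyclic sets of vectors -/

section Cyclic

variable {H : Type*} [NormedAddCommGroup H] [InnerProductSpace ℂ H] [CompleteSpace H]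

/-- The vectors `y ω` with `y ∈ Y` and `ω ∈ Ω` span a dense subspace, stated as an induction
principle: a closed subspace containing all of them is the whole space. -/
def IsCyclicFor (Y : Set (H →L[ℂ] H)) (Ω : Set H) : Prop :=
  ∀ V : Submodule ℂ H, IsClosed (V : Set H) → (∀ y ∈ Y, ∀ ω ∈ Ω, y ω ∈ V) → V = ⊤

namespace VonNeumannAlgebra

/-- A set of vectors separating for `M` is cyclic for the commutant of `M`: the projection onto the
closed span of its orbit lies in `M` and fixes `Ω`. -/
theorem isCyclicFor_centralizer {M : VonNeumannAlgebra H} {Ω : Set H}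
    (hΩ : ∀ x ∈ M, (∀ ω ∈ Ω, x ω = 0) → x = 0) :
    IsCyclicFor (Set.centralizer (M : Set (H →L[ℂ] H))) Ω := by
  intro V hV hVΩ
  let V₀ : Submodule ℂ H := Submodule.topologicalClosure (Submodule.span ℂ
    (Set.image2 (fun (y : H →L[ℂ] H) ω => y ω) (Set.centralizer (M : Set (H →L[ℂ] H))) Ω))
  have hle : V₀ ≤ V := by
    refine Submodule.topologicalClosure_minimal _ (Submodule.span_le.2 ?_) hV
    rintro - ⟨y, hy, ω, hω, rfl⟩
    exact hVΩ y hy ω hω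
  have hcl : IsClosed (V₀ : Set H) := Submodule.isClosed_topologicalClosure _
  have : CompleteSpace V₀ := hcl.completeSpace_coe
  have hmem {y : H →L[ℂ] H} (hy : y ∈ Set.centralizer (M : Set (H →L[ℂ] H))) {ω : H}
      (hω : ω ∈ Ω) : y ω ∈ V₀ :=
    Submodule.le_topologicalClosure _ (Submodule.subset_span ⟨y, hy, ω, hω, rfl⟩)
  have hinv (y : H →L[ℂ] H) (hy : y ∈ Set.centralizer (M : Set (H →L[ℂ] H))) :
      ∀ v ∈ V₀, y v ∈ V₀ := by
    have h : V₀ ≤ V₀.comap (y : H →ₗ[ℂ] H) := by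
      refine Submodule.topologicalClosure_minimal _ (Submodule.span_le.2 ?_)
        (hcl.preimage y.continuous)
      rintro - ⟨z, hz, ω, hω, rfl⟩
      exact hmem (Set.mul_mem_centralizer hy hz) hω
    exact h
  have hP : V₀.starProjection ∈ M := by
    refine mem_of_forall_commute fun y hy => ?_
    have hy' : star y ∈ Set.centralizer (M : Set (H →L[ℂ] H)) := by
      rw [← coe_commutant] at hy ⊢
      exact star_mem hy
    ext v
    exact (starProjection_comm_of_invariant (a := y) (b := star y)
      (fun v w => by
        rw [ContinuousLinearMap.star_eq_adjoint, ContinuousLinearMap.adjoint_inner_left])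
      (hinv y hy) (hinv _ hy') v).symm
  have h1 : (1 : H →L[ℂ] H) - V₀.starProjection = 0 := by
    refine hΩ _ (sub_mem (one_mem M) hP) fun ω hω => ?_
    have hωV : ω ∈ V₀ := hmem (y := 1) (Set.one_mem_centralizer) hω
    change ω - V₀.starProjection ω = 0
    rw [Submodule.starProjection_eq_self_iff.2 hωV, sub_self]
  refine eq_top_iff.2 fun v _ => hle (Submodule.starProjection_eq_self_iff.1 ?_)
  rw [← sub_eq_zero.1 h1]
  rfl

/-- If `Ω` is cyclic for the commutant of `A`, then strong-* approximation on pairs of vectors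
of `Ω` decides whether an element of `A` lies in a subalgebra `R`. -/
theorem mem_of_mem_closure_image_star {A R : VonNeumannAlgebra H} (hRA : R ≤ A) {Ω : Set H}
    (hΩ : IsCyclicFor (Set.centralizer (A : Set (H →L[ℂ] H))) Ω) {q : H →L[ℂ] H} (hq : q ∈ A)
    (h : ∀ ω ∈ Ω, ∀ ω' ∈ Ω,
      (q ω, star q ω') ∈ closure ((fun t : H →L[ℂ] H => (t ω, star t ω')) '' R)) : q ∈ R := by
  refine mem_of_forall_commute fun y hy => ?_
  have key (ω : H) (hω : ω ∈ Ω) (ω' : H) (hω' : ω' ∈ Ω) (a b : H →L[ℂ] H)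
      (ha : a ∈ Set.centralizer (A : Set (H →L[ℂ] H)))
      (hb : b ∈ Set.centralizer (A : Set (H →L[ℂ] H))) :
      ⟪a ω', y (q (b ω))⟫_ℂ = ⟪a ω', q (y (b ω))⟫_ℂ := by
    have hcl : IsClosed {p : H × H | ⟪a ω', y (b p.1)⟫_ℂ = ⟪a p.2, y (b ω)⟫_ℂ} :=
      isClosed_eq (by fun_prop) (by fun_prop)
    have comm {z : H →L[ℂ] H} {X : Set (H →L[ℂ] H)} {c : H →L[ℂ] H}
        (hc : c ∈ Set.centralizer X) (hz : z ∈ X) (v : H) : z (c v) = c (z v) :=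
      congrArg (fun f : H →L[ℂ] H => f v) (Set.mem_centralizer_iff.1 hc z hz)
    have hmem := closure_minimal (fun p hp => ?_) hcl (h ω hω ω' hω')
    · have h' : ⟪a ω', y (b (q ω))⟫_ℂ = ⟪a (star q ω'), y (b ω)⟫_ℂ := hmem
      rw [comm hb hq, h', ← comm ha (star_mem hq : star q ∈ A),
        ContinuousLinearMap.star_eq_adjoint, ContinuousLinearMap.adjoint_inner_left]
    · obtain ⟨t, ht, rfl⟩ := hp
      change ⟪a ω', y (b (t ω))⟫_ℂ = ⟪a (star t ω'), y (b ω)⟫_ℂ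
      rw [← comm hb (hRA ht), ← comm ha (hRA (star_mem ht) : star t ∈ A),
        ← comm hy ht, ContinuousLinearMap.star_eq_adjoint,
        ContinuousLinearMap.adjoint_inner_left]
  have h₁ (ω' : H) (hω' : ω' ∈ Ω) (a : H →L[ℂ] H)
      (ha : a ∈ Set.centralizer (A : Set (H →L[ℂ] H))) (v : H) :
      ⟪a ω', (y * q - q * y) v⟫_ℂ = 0 := by
    let φ : H →L[ℂ] ℂ := innerSL ℂ (a ω') ∘L (y * q - q * y)
    have hφ : LinearMap.ker (φ : H →ₗ[ℂ] ℂ) = ⊤ := by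
      refine hΩ _ φ.isClosed_ker fun b hb ω hω => ?_
      change ⟪a ω', y (q (b ω)) - q (y (b ω))⟫_ℂ = 0
      rw [inner_sub_right, key ω hω ω' hω' a b ha hb, sub_self]
    exact LinearMap.mem_ker.1 (hφ ▸ Submodule.mem_top : v ∈ LinearMap.ker (φ : H →ₗ[ℂ] ℂ))
  have h₂ : y * q - q * y = 0 := by
    ext v
    have hV := hΩ (ℂ ∙ ((y * q - q * y) v))ᗮ (Submodule.isClosed_orthogonal _)
      fun a ha ω' hω' => by
        rw [Submodule.mem_orthogonal_singleton_iff_inner_left]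
        exact h₁ ω' hω' a ha v
    have hmem : (y * q - q * y) v ∈ (ℂ ∙ ((y * q - q * y) v))ᗮ := hV ▸ Submodule.mem_top
    rw [Submodule.mem_orthogonal_singleton_iff_inner_left, inner_self_eq_zero] at hmem
    exact hmem
  exact sub_eq_zero.1 h₂

/-- Every element of the von Neumann algebra generated by `G` lies in one generated by a countable
part of `G`, provided that the commutant has a countable cyclic set of vectors. -/
theorem exists_countable_mem_generatedBy {G : Set (H →L[ℂ] H)}
    (hG : IsDenseScalarStarAlgebra (Submodule.span ℂ G : Set (H →L[ℂ] H))) {Ω : Set H}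
    (hΩc : Ω.Countable)
    (hΩ : IsCyclicFor (Set.centralizer (generatedBy G : Set (H →L[ℂ] H))) Ω)
    {q : H →L[ℂ] H} (hq : q ∈ generatedBy G) :
    ∃ C ⊆ G, C.Countable ∧ q ∈ generatedBy C := by
  have hqW : q ∈ Set.centralizer (Set.centralizer (Submodule.span ℂ G : Set (H →L[ℂ] H))) := by
    rw [← coe_generatedBy_of_star_mem hG.star_mem]
    exact generatedBy_le (Submodule.subset_span.trans (subset_generatedBy _)) hq
  have hseq (ω ω' : H) : ∃ C ⊆ G, C.Countable ∧ (q ω, star q ω') ∈ closure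
      ((fun t : H →L[ℂ] H => (t ω, star t ω')) '' (Submodule.span ℂ C : Set (H →L[ℂ] H))) := by
    obtain ⟨p, hp, hlim⟩ := mem_closure_iff_seq_limit.1 (mem_closure_image_star hG hqW ω ω')
    choose t ht htp using hp
    choose C hCG htC using fun n => Submodule.mem_span_finite_of_mem_span (ht n)
    refine ⟨⋃ n, (C n : Set (H →L[ℂ] H)), Set.iUnion_subset hCG,
      Set.countable_iUnion fun n => (C n).countable_toSet,
      mem_closure_iff_seq_limit.2 ⟨p, fun n => ⟨t n, ?_, htp n⟩, hlim⟩⟩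
    exact Submodule.span_mono (Set.subset_iUnion (fun n => (C n : Set (H →L[ℂ] H))) n) (htC n)
  choose C hCG hCc hC using hseq
  have hsub : (⋃ ω ∈ Ω, ⋃ ω' ∈ Ω, C ω ω') ⊆ G :=
    Set.iUnion₂_subset fun ω _ => Set.iUnion₂_subset fun ω' _ => hCG ω ω'
  refine ⟨_, hsub, hΩc.biUnion fun ω _ => hΩc.biUnion fun ω' _ => hCc ω ω', ?_⟩
  refine mem_of_mem_closure_image_star
    (generatedBy_le (hsub.trans (subset_generatedBy G))) hΩ hq fun ω hω ω' hω' => ?_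
  refine closure_mono (Set.image_mono ?_) (hC ω ω')
  have hspan : Submodule.span ℂ (C ω ω') ≤
      Subalgebra.toSubmodule (generatedBy (⋃ ω ∈ Ω, ⋃ ω' ∈ Ω, C ω ω')).toSubalgebra := by
    refine Submodule.span_le.2 fun z hz => subset_generatedBy _ ?_
    exact Set.mem_biUnion hω (Set.mem_biUnion hω' hz)
  exact hspan

end VonNeumannAlgebra

end Cyclic

/-! ### Operators on the Hilbert space tensor product -/

section Tensor

variable {H : Type*} [NormedAddCommGroup H] [InnerProductSpace ℂ H]
  {K : Type*} [NormedAddCommGroup K] [InnerProductSpace ℂ K]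

/-- The elementary tensor `ξ ⊗ η` in the Hilbert space tensor product. -/
def hilbertTmul (ξ : H) (η : K) : HilbertTensor H K := ((ξ ⊗ₜ[ℂ] η : H ⊗[ℂ] K) : HilbertTensor H K)

theorem eq_top_of_hilbertTmul_mem {V : Submodule ℂ (HilbertTensor H K)}
    (hV : IsClosed (V : Set (HilbertTensor H K))) (h : ∀ ξ η, hilbertTmul ξ η ∈ V) : V = ⊤ := by
  refine (Submodule.eq_top_iff' (p := V)).2 fun z => ?_
  induction z using UniformSpace.Completion.induction_on with
  | hp => exact hV
  | ih t =>
    induction t with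
    | zero => exact V.zero_mem
    | tmul ξ η => exact h ξ η
    | add s t hs ht =>
      rw [UniformSpace.Completion.coe_add]
      exact V.add_mem hs ht

theorem ext_hilbertTmul {f g : HilbertTensor H K →L[ℂ] HilbertTensor H K}
    (h : ∀ ξ η, f (hilbertTmul ξ η) = g (hilbertTmul ξ η)) : f = g := by
  have hV := eq_top_of_hilbertTmul_mem (V := LinearMap.ker (f - g).toLinearMap)
    (f - g).isClosed_ker fun ξ η => sub_eq_zero.2 (h ξ η)
  ext z
  exact sub_eq_zero.1 (Submodule.eq_top_iff'.1 hV z)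

theorem tensorOperator_hilbertTmul (a : H →L[ℂ] H) (b : K →L[ℂ] K) (ξ : H) (η : K) :
    tensorOperator a b (hilbertTmul ξ η) = hilbertTmul (a ξ) (b η) :=
  tensorOperator_tmul a b ξ η

theorem tensorOperator_mul (a a' : H →L[ℂ] H) (b b' : K →L[ℂ] K) :
    tensorOperator (a * a') (b * b') = tensorOperator a b * tensorOperator a' b' :=
  ext_hilbertTmul fun ξ η => by simp [tensorOperator_hilbertTmul, mul_apply_eq_comp]

theorem tensorOperator_one : tensorOperator (1 : H →L[ℂ] H) (1 : K →L[ℂ] K) = 1 :=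
  ext_hilbertTmul fun ξ η => by simp [tensorOperator_hilbertTmul]

variable [CompleteSpace H] [CompleteSpace K]

theorem star_tensorOperator (a : H →L[ℂ] H) (b : K →L[ℂ] K) :
    star (tensorOperator a b) = tensorOperator (star a) (star b) := by
  rw [ContinuousLinearMap.star_eq_adjoint, eq_comm, ContinuousLinearMap.eq_adjoint_iff]
  intro z w
  induction z, w using UniformSpace.Completion.induction_on₂ with
  | hp => exact isClosed_eq (by fun_prop) (by fun_prop)
  | ih s t =>
    simp only [tensorOperator, ContinuousLinearMap.completion_apply_coe,
      UniformSpace.Completion.inner_coe]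
    induction s with
    | zero => simp
    | add s s' hs hs' => rw [map_add, inner_add_left, inner_add_left, hs, hs']
    | tmul ξ η =>
      induction t with
      | zero => simp
      | add t t' ht ht' => rw [map_add, inner_add_right, inner_add_right, ht, ht']
      | tmul ξ' η' =>
        simp [ContinuousLinearMap.star_eq_adjoint, ContinuousLinearMap.adjoint_inner_left]

namespace VonNeumannAlgebra

/-- The elementary tensors of elements of `M` and `N`, which generate `M.tensor N`. -/
def elementaryTensors (M : VonNeumannAlgebra H) (N : VonNeumannAlgebra K) :
    Set (HilbertTensor H K →L[ℂ] HilbertTensor H K) :=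
  {T | ∃ a ∈ M, ∃ b ∈ N, T = tensorOperator a b}

variable {M : VonNeumannAlgebra H} {N : VonNeumannAlgebra K}

theorem star_mem_elementaryTensors {x : HilbertTensor H K →L[ℂ] HilbertTensor H K}
    (hx : x ∈ elementaryTensors M N) : star x ∈ elementaryTensors M N := by
  obtain ⟨a, ha, b, hb, rfl⟩ := hx
  exact ⟨star a, star_mem ha, star b, star_mem hb, star_tensorOperator a b⟩

theorem isDenseScalarStarAlgebra_span_elementaryTensors :
    IsDenseScalarStarAlgebra (Submodule.span ℂ (elementaryTensors M N) :
      Set (HilbertTensor H K →L[ℂ] HilbertTensor H K)) := by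
  refine isDenseScalarStarAlgebra_span ⟨1, one_mem M, 1, one_mem N, tensorOperator_one.symm⟩ ?_
    fun x hx => star_mem_elementaryTensors hx
  rintro - ⟨a, ha, b, hb, rfl⟩ - ⟨a', ha', b', hb', rfl⟩
  exact ⟨a * a', mul_mem ha ha', b * b', mul_mem hb hb', (tensorOperator_mul a a' b b').symm⟩

theorem tensorOperator_mem_centralizer_tensor {a : H →L[ℂ] H} {b : K →L[ℂ] K}
    (ha : a ∈ Set.centralizer (M : Set (H →L[ℂ] H)))
    (hb : b ∈ Set.centralizer (N : Set (K →L[ℂ] K))) :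
    tensorOperator a b ∈ Set.centralizer
      (M.tensor N : Set (HilbertTensor H K →L[ℂ] HilbertTensor H K)) := by
  have h : (M.tensor N : Set (HilbertTensor H K →L[ℂ] HilbertTensor H K)) =
      Set.centralizer (Set.centralizer (elementaryTensors M N)) :=
    coe_generatedBy_of_star_mem fun _ hx => star_mem_elementaryTensors hx
  rw [h, Set.centralizer_centralizer_centralizer, Set.mem_centralizer_iff]
  rintro - ⟨c, hc, d, hd, rfl⟩
  rw [← tensorOperator_mul, ← tensorOperator_mul, Set.mem_centralizer_iff.1 ha c hc,
    Set.mem_centralizer_iff.1 hb d hd]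

theorem isCyclicFor_centralizer_tensor {Ω : Set H} {Ω' : Set K}
    (hΩ : IsCyclicFor (Set.centralizer (M : Set (H →L[ℂ] H))) Ω)
    (hΩ' : IsCyclicFor (Set.centralizer (N : Set (K →L[ℂ] K))) Ω') :
    IsCyclicFor (Set.centralizer
      (M.tensor N : Set (HilbertTensor H K →L[ℂ] HilbertTensor H K)))
      (Set.image2 hilbertTmul Ω Ω') := by
  intro V hV hVΩ
  let L (η : K) : H →L[ℂ] HilbertTensor H K :=
    UniformSpace.Completion.toComplL ∘L (TensorProduct.mkL ℂ H K).flip η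
  let R (ξ : H) : K →L[ℂ] HilbertTensor H K :=
    UniformSpace.Completion.toComplL ∘L TensorProduct.mkL ℂ H K ξ
  have h₁ (b : K →L[ℂ] K) (hb : b ∈ Set.centralizer (N : Set (K →L[ℂ] K))) (η : K)
      (hη : η ∈ Ω') (ξ : H) : hilbertTmul ξ (b η) ∈ V := by
    have h : V.comap (L (b η) : H →ₗ[ℂ] HilbertTensor H K) = ⊤ := by
      refine hΩ _ (hV.preimage (L (b η)).continuous) fun a ha ω hω => ?_
      have := hVΩ _ (tensorOperator_mem_centralizer_tensor ha hb) _ ⟨ω, hω, η, hη, rfl⟩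
      rwa [tensorOperator_hilbertTmul] at this
    exact (h ▸ Submodule.mem_top : ξ ∈ V.comap (L (b η) : H →ₗ[ℂ] HilbertTensor H K))
  refine eq_top_of_hilbertTmul_mem hV fun ξ η => ?_
  have h : V.comap (R ξ : K →ₗ[ℂ] HilbertTensor H K) = ⊤ :=
    hΩ' _ (hV.preimage (R ξ).continuous) fun b hb ω hω => h₁ b hb ω hω ξ
  exact (h ▸ Submodule.mem_top : η ∈ V.comap (R ξ : K →ₗ[ℂ] HilbertTensor H K))

/-- An element of `M.tensor N` only involves countably many elements of `M` and `N`. -/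
theorem exists_countable_mem_generatedBy_tensorOperator {Ω : Set H} {Ω' : Set K}
    (hΩc : Ω.Countable) (hΩc' : Ω'.Countable) (hΩ : ∀ x ∈ M, (∀ ω ∈ Ω, x ω = 0) → x = 0)
    (hΩ' : ∀ x ∈ N, (∀ ω ∈ Ω', x ω = 0) → x = 0)
    {q : HilbertTensor H K →L[ℂ] HilbertTensor H K} (hq : q ∈ M.tensor N) :
    ∃ C ⊆ elementaryTensors M N, C.Countable ∧ q ∈ generatedBy C :=
  exists_countable_mem_generatedBy isDenseScalarStarAlgebra_span_elementaryTensors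
    (hΩc.image2 hΩc' hilbertTmul)
    (isCyclicFor_centralizer_tensor (isCyclicFor_centralizer hΩ) (isCyclicFor_centralizer hΩ')) hq

end VonNeumannAlgebra

end Tensor

end

theorem lemma4p1
    {H : Type*} [NormedAddCommGroup H] [InnerProductSpace ℂ H] [CompleteSpace H]
    {K : Type*} [NormedAddCommGroup K] [InnerProductSpace ℂ K] [CompleteSpace K]
    (M : VonNeumannAlgebra H) (N : VonNeumannAlgebra K)
    (hM : M.IsTypeII1) (hN : N.IsTypeII1)
    (τM : M.toStarSubalgebra →ₗ[ℂ] ℂ) (hτM : M.IsFaithfulNormalTrace τM)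
    (τN : N.toStarSubalgebra →ₗ[ℂ] ℂ) (hτN : N.IsFaithfulNormalTrace τN)
    (Q : VonNeumannAlgebra (HilbertTensor H K))
    (hQ : Q ≤ M.tensor N) (hQsep : Q.IsSeparable) :
    ∃ (M₀ : VonNeumannAlgebra H) (N₀ : VonNeumannAlgebra K),
      M₀ ≤ M ∧ N₀ ≤ N ∧
      M₀.IsTypeII1 ∧ N₀.IsTypeII1 ∧
      M₀.IsSeparable ∧ N₀.IsSeparable ∧
      Q ≤ M₀.tensor N₀ := by
  obtain ⟨D, hDc, hDQ, hQD⟩ := hQsep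
  obtain ⟨Ω, hΩc, hΩ⟩ := hτM.exists_countable_separating
  obtain ⟨Ω', hΩc', hΩ'⟩ := hτN.exists_countable_separating
  have hD (d : D) := VonNeumannAlgebra.exists_countable_mem_generatedBy_tensorOperator
    hΩc hΩc' hΩ hΩ' (hQ (hDQ d.2))
  choose C hCG hCc hdC using hD
  have : Countable D := hDc.to_subtype
  have hCc' : (⋃ d, C d).Countable := Set.countable_iUnion hCc
  have hex (T : ⋃ d, C d) : T.1 ∈ VonNeumannAlgebra.elementaryTensors M N :=
    Set.iUnion_subset hCG T.2
  choose a haM b hbN hab using hex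
  have : Countable (⋃ d, C d) := hCc'.to_subtype
  obtain ⟨M₀, hM₀M, haM₀, hM₀, hM₀s⟩ := VonNeumannAlgebra.exists_separable_isTypeII1 hM hτM
    (Set.countable_range a) (Set.range_subset_iff.2 haM)
  obtain ⟨N₀, hN₀N, hbN₀, hN₀, hN₀s⟩ := VonNeumannAlgebra.exists_separable_isTypeII1 hN hτN
    (Set.countable_range b) (Set.range_subset_iff.2 hbN)
  refine ⟨M₀, N₀, hM₀M, hN₀N, hM₀, hN₀, hM₀s, hN₀s, fun q hq => ?_⟩
  refine closure_ultraweak_subset (fun d hd => ?_) (hQD hq)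
  refine VonNeumannAlgebra.generatedBy_le (fun T hT => ?_) (hdC ⟨d, hd⟩)
  let T' : ⋃ d, C d := ⟨T, Set.mem_iUnion_of_mem _ hT⟩
  exact VonNeumannAlgebra.subset_generatedBy _
    ⟨a T', haM₀ ⟨T', rfl⟩, b T', hbN₀ ⟨T', rfl⟩, hab T'⟩
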